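/- **Theorem.** *The network.* Consider a finite set $V$ of nodes, a finite set $E$ of directed edges $e=(v,u)$ and a finite set $D$ of destinations, each destination being a set of nodes. Time is divided into slots $t=0,1,2,\dots$. In slot $t$ an adversary specifies a nonempty set $R(t)\subset\mathbb R^{E}$ of feasible edge rate vectors and injects finitely many packets; a packet $p$ has an injection time $t_p$, a source node, a destination $d_p\in D$ and a size $\ell_p>0$. If $r\in R(t)$, then in slot $t$ amounts $0\le x_e\le r_e$ can be transmitted on all edges $e$ simultaneously. Besides this the sets $R(t)$ are arbitrary (any interference constraints). For constants $R_{\min},R_{\max}>0$, every edge rate $r_e$ with $r\in R(t)$, and every arrival rate (the total size of the packets injected in one slot at one node for one destination), is at most $R_{\max}$ and is either $0$ or at least $R_{\min}$. *The adversary.* Let $\omega\ge1$ be an integer and $0<\varepsilon<2$. The adversary is an $(\omega,\varepsilon)$-adversary if there are vectors $r(t)\in R(t)$ and amounts $\ell(p,e,t')\ge 0$ (the amount of $p$ sent along $e$ in slot $t'\ge t_p$) such that (i) for every $p$, the amount of $p$ at each node, when $p$ starts at its source at time $t_p$ and is moved according to $\ell$, never becomes negative; (ii) for every $p$, after the slots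 $t_p,\dots,t_p+\omega-1$ at least $(1-\frac{\varepsilon}{2})\ell_p$ of $p$ is at nodes of $d_p$; (iii) for every $j\ge0$, with $W_j=[j\omega,(j+1)\omega-1]$ and $I^j$ the set of packets injected during $W_j$ ($I^{-1}=\emptyset$), and for every edge $e$, $$\sum_{p\in I^{j}\cup I^{j-1}}\ \sum_{t'\in W_j,\ t_p\le t'\le t_p+\omega-1}\ell(p,e,t')\ \le\ \sum_{t'\in W_j}(1-\varepsilon)\,r_e(t').$$ *The protocol.* Max-Weight keeps at each node $v$ and for each $d\in D$ a queue of size $q^t_{v,d}\ge0$, with $q^t_{v,d}=0$ for $v\in d$. In slot $t$ it chooses, with arbitrary tie-breaking, a nonnegative vector $r=(r_e)$ bounded coordinatewise by some element of $R(t)$ and destinations $d^{(e)}\in D$ that maximize $$\sum_{e=(v,u)\in E}s_e\bigl(q^t_{v,d^{(e)}}-q^t_{u,d^{(e)}}\bigr),\qquad s_e=\min\Bigl\{r_e,\Bigl|\tfrac{q^t_{v,d^{(e)}}-q^t_{u,d^{(e)}}}{2}\Bigr|\Bigr\};$$ it sends data of size $s_e$ from the queue $(v,d^{(e)})$ to the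 queue $(u,d^{(e)})$ along each edge $e$ (if a queue holds less than the total of the amounts $s_e$ that are to leave it, its whole content is split among these edges in an arbitrary way, at most $s_e$ on each), then accepts the injected packets, and then removes all data that is at its destination. *Claim.* Max-Weight is stable under every $(\omega,\varepsilon)$-adversary: for every $q_0$ there is a constant $B$, depending only on the network, $\omega$, $\varepsilon$, $R_{\min}$, $R_{\max}$ and $q_0$, such that $q^t_{v,d}\le B$ for all $t$, $v$, $d$ in every execution of Max-Weight against an $(\omega,\varepsilon)$-adversary with the rate bounds $R_{\min},R_{\max}$ whose initial queue sizes are at most $q_0$. -/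

import Mathlib

open Finset

namespace AdversarialQueueing

/-- A network with node set `V`, directed edges `E` (from `tail e` to `head e`) and destinations
`D`. Each destination is a set of nodes; data is delivered when it reaches any one of them. -/
structure Network (V E D : Type*) where
  tail : E → V
  head : E → V
  target : D → Finset V

/-- A packet: where it is injected, its destination and its amount of data. -/
structure Packet (V D : Type*) where
  source : V
  dest : D
  size : ℝ
  size_pos : 0 < size

/-- Everything the adversary controls: the set `rates t` of feasible edge rate vectors in slot `t`
and the finitely many packets `packet t i`, `i < count t`, that it injects in slot `t`. -/
structure Adversary (V E D : Type*) where
  rates : ℕ → Set (E → ℝ)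
  count : ℕ → ℕ
  packet : (t : ℕ) → Fin (count t) → Packet V D

section

variable {V E D : Type*} [Fintype V] [Fintype E] [Fintype D] [DecidableEq V] [DecidableEq D]

namespace Adversary

/-- The amount of data with destination `d` injected at node `v` in slot `t`. -/
def arrival (A : Adversary V E D) (t : ℕ) (v : V) (d : D) : ℝ :=
  ∑ i : Fin (A.count t),
    if (A.packet t i).source = v ∧ (A.packet t i).dest = d then (A.packet t i).size else 0

/-- Edge rates and arrival rates are at most `Rmax`, and at least `Rmin` where they are nonzero. -/
structure HasBoundedRates (A : Adversary V E D) (Rmin Rmax : ℝ) : Prop where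
  edge_le : ∀ t, ∀ r ∈ A.rates t, ∀ e, r e ≤ Rmax
  le_edge : ∀ t, ∀ r ∈ A.rates t, ∀ e, r e ≠ 0 → Rmin ≤ r e
  arrival_le : ∀ t v d, A.arrival t v d ≤ Rmax
  le_arrival : ∀ t v d, A.arrival t v d ≠ 0 → Rmin ≤ A.arrival t v d

/-- A fractional movement of all packets by some routing and scheduling algorithm together with
the rate vectors the algorithm uses: `move t i e s` is the amount of the packet `packet t i` that
is sent along the edge `e` in slot `s`. -/
structure Schedule (A : Adversary V E D) where
  rate : ℕ → E → ℝ
  move : (t : ℕ) → Fin (A.count t) → E → ℕ → ℝ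

/-- The amount of the packet `packet t i` that is at node `v` at the beginning of slot `s ≥ t`
when the packet is moved as `T` says. -/
def Schedule.held {A : Adversary V E D} (T : A.Schedule) (N : Network V E D)
    (t : ℕ) (i : Fin (A.count t)) (v : V) (s : ℕ) : ℝ :=
  (if (A.packet t i).source = v then (A.packet t i).size else 0) +
    ∑ s' ∈ Ico t s, ((∑ e : E, if N.head e = v then T.move t i e s' else 0) -
      ∑ e : E, if N.tail e = v then T.move t i e s' else 0)

/-- `T` witnesses the constraint on an `(ω, ε)`-adversary. -/
structure Schedule.IsWitness {A : Adversary V E D} (T : A.Schedule) (N : Network V E D)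
    (ω : ℕ) (ε : ℝ) : Prop where
  rate_mem : ∀ t, T.rate t ∈ A.rates t
  move_nonneg : ∀ t i e s, 0 ≤ T.move t i e s
  /-- No node ever sends data of a packet that it does not have. -/
  held_nonneg : ∀ t i v s, t ≤ s → 0 ≤ T.held N t i v s
  /-- A fraction `1 - ε / 2` of each packet is at its destination at the end of the slots
  `t, …, t + ω - 1`, where `t` is the slot of its injection. -/
  delivered : ∀ t i, (1 - ε / 2) * (A.packet t i).size ≤
    ∑ v ∈ N.target (A.packet t i).dest, T.held N t i v (t + ω)
  /-- In each window `jω ≤ s < (j + 1)ω` the movements of the packets injected in this window and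
  in the one before it (there is none before the window `j = 0`), each counted in the `ω` slots
  that follow its injection, use at most a fraction `1 - ε` of the rate of every edge. -/
  load_le : ∀ (j : ℕ) (e : E),
    ∑ s ∈ Ico (j * ω) ((j + 1) * ω), ∑ t ∈ Ico ((j - 1) * ω) ((j + 1) * ω),
        ∑ i : Fin (A.count t), (if t ≤ s ∧ s < t + ω then T.move t i e s else 0) ≤
      ∑ s ∈ Ico (j * ω) ((j + 1) * ω), (1 - ε) * T.rate s e

/-- `A` is an `(ω, ε)`-adversary: some schedule, unknown to the protocol, serves its packets. -/
def IsWindowAdversary (A : Adversary V E D) (N : Network V E D) (ω : ℕ) (ε : ℝ) : Prop :=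
  ∃ T : A.Schedule, T.IsWitness N ω ε

end Adversary

/-- The downward closure of a set of rate vectors: a rate may always be used only in part. -/
def downClosure (R : Set (E → ℝ)) : Set (E → ℝ) :=
  {x | (∀ e, 0 ≤ x e) ∧ ∃ r ∈ R, ∀ e, x e ≤ r e}

namespace Network

/-- The queue differential of edge `e` for destination `d`. -/
def diff (N : Network V E D) (q : V → D → ℝ) (e : E) (d : D) : ℝ :=
  q (N.tail e) d - q (N.head e) d

/-- The amount `s_e = min {r_e, |differential / 2|}` that Max-Weight sends along `e`. -/
noncomputable def sent (N : Network V E D) (q : V → D → ℝ) (r : E → ℝ) (δ : E → D) (e : E) : ℝ :=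
  min (r e) |N.diff q e (δ e) / 2|

/-- The total weight of a choice of rates `r` and of a destination `δ e` for each edge `e`. -/
noncomputable def weight (N : Network V E D) (q : V → D → ℝ) (r : E → ℝ) (δ : E → D) : ℝ :=
  ∑ e : E, N.sent q r δ e * N.diff q e (δ e)

/-- `r` and `δ` maximize the weight for queue sizes `q` and feasible rate vectors `R`. -/
def IsMaxWeightChoice (N : Network V E D) (R : Set (E → ℝ)) (q : V → D → ℝ)
    (r : E → ℝ) (δ : E → D) : Prop :=
  r ∈ downClosure R ∧ ∀ r' ∈ downClosure R, ∀ δ' : E → D, N.weight q r' δ' ≤ N.weight q r δ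

/-- The sum of `x e` over the edges `e` that leave `v` and serve destination `d`. -/
def outflow (N : Network V E D) (δ : E → D) (x : E → ℝ) (v : V) (d : D) : ℝ :=
  ∑ e : E, if N.tail e = v ∧ δ e = d then x e else 0

/-- The sum of `x e` over the edges `e` that enter `v` and serve destination `d`. -/
def inflow (N : Network V E D) (δ : E → D) (x : E → ℝ) (v : V) (d : D) : ℝ :=
  ∑ e : E, if N.head e = v ∧ δ e = d then x e else 0

/-- One slot of Max-Weight, from queue sizes `q` to `q'`, with feasible rate vectors `R` and
arrivals `a`. The amount `sent` goes along each edge. Only if a queue holds less than the total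
that its outgoing edges should take, its whole content is split among them in an arbitrary way.
Then the arrivals are accepted and data at its destination is removed. -/
def MaxWeightStep (N : Network V E D) (R : Set (E → ℝ)) (a q q' : V → D → ℝ) : Prop :=
  ∃ (r : E → ℝ) (δ : E → D) (f : E → ℝ),
    N.IsMaxWeightChoice R q r δ ∧
    (∀ e, 0 ≤ f e ∧ f e ≤ N.sent q r δ e) ∧
    (∀ v d, N.outflow δ f v d = min (q v d) (N.outflow δ (N.sent q r δ) v d)) ∧
    (∀ v d, q' v d =
      if v ∈ N.target d then 0 else q v d - N.outflow δ f v d + N.inflow δ f v d + a v d)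

/-- `q t v d` is the size at time `t` of the queue at node `v` for destination `d` in an execution
of Max-Weight (with any tie-breaking) against the adversary `A`, from any initial queue sizes. -/
structure IsMaxWeightRun (N : Network V E D) (A : Adversary V E D) (q : ℕ → V → D → ℝ) :
    Prop where
  init_nonneg : ∀ v d, 0 ≤ q 0 v d
  init_target : ∀ d, ∀ v ∈ N.target d, q 0 v d = 0
  step : ∀ t, N.MaxWeightStep (A.rates t) (A.arrival t) (q t) (q (t + 1))

end Network

end

end AdversarialQueueing

/-! The natural potential is the sum of squared queue sizes. Max-Weight maximizes its decrease in a
slot up to bounded errors, and the adversary's schedule exhibits feasible rates with slack. Packets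
may straddle two windows, so the potential `Φ` subtracts a multiple of the work that packets of the
previous window still require. Over a window `Φ` then falls by a multiple of `w`, up to a constant,
where `w` is essentially the chosen weights plus the arrivals weighted by queue size
(`exists_linkedDrift`).

This alone does not bound `Φ`: `w` can stay small while queues are large, because large queues may
be left without arrivals and without usable edges. What helps is that, by `Rmin`, a transfer across
a large level difference, or an arrival at a large queue, forces `w` to be large (`link_le`). Queues
at very different levels can therefore interact only at the price of a large drop of `Φ`.

The rest concerns vectors only (`LinkedDrift`) and is an induction over partitions of the
coordinates that no link crosses (`stableAt_succ`). When all blocks have small diameter,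
conservation of block sums makes the current vector nearly a minimizer of the sum of squares, so `Φ`
cannot be much above any earlier value (`potential_le_of_small`). Otherwise some block has a wide
gap. The partition refined at this gap is controlled by induction until a link crosses the gap or
the gap shrinks, and either event means that `Φ` has dropped by at least one (`of_spread`). Hence
`Φ` is bounded, and since its correction is linear in the queues, so are the queues
(`le_of_sum_sq_le`). -/

namespace AdversarialQueueing

/-! ### Linked vectors with drift, and partitions of their coordinates -/

/-- A sequence of vectors `x t` that changes by transfers along the links `L t` only, where the
base point `o` is an unlimited store at level `0`. The potential `Φ` is close to the sum of squares
and falls by at least a multiple of the largest level difference of a link, up to a constant. -/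
structure LinkedDrift {ι : Type*} [Fintype ι] (o : ι) (C c : ℝ) (x : ℕ → ι → ℝ) (w Φ : ℕ → ℝ)
    (L : ℕ → ι → ι → Prop) : Prop where
  base : ∀ t, x t o = 0
  step_le : ∀ t i, |x (t + 1) i - x t i| ≤ C
  conserve : ∀ t (m : ι → ℝ), m o = 0 → (∀ i j, L t i j → m i = m j) →
    ∑ i, m i * x (t + 1) i = ∑ i, m i * x t i
  link_le : ∀ t i j, L t i j → |x t i - x t j| ≤ w t
  w_nonneg : ∀ t, 0 ≤ w t
  drift : ∀ t, Φ (t + 1) ≤ Φ t + C - c * w t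
  le_sq : ∀ t, Φ t ≤ ∑ i, x t i ^ 2
  sq_le : ∀ t, ∑ i, x t i ^ 2 ≤ Φ t + C * (1 + w t)

/-- If two values of `f` are far apart then some gap between consecutive values is large. -/
theorem exists_gap {ι : Type*} [Fintype ι] (f : ι → ℝ) {g : ℝ} {i₀ j₀ : ι}
    (hg : 0 ≤ g) (h : f j₀ + Fintype.card ι * g < f i₀) :
    ∃ T : Set ι, i₀ ∈ T ∧ j₀ ∉ T ∧ ∀ i ∈ T, ∀ j ∉ T, g ≤ f i - f j := by
  have hex : ∃ k : Fin (Fintype.card ι), ∀ i, f j₀ + k * g < f i → f j₀ + (k + 1) * g < f i := by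
    -- If each of the `card ι` half-open intervals of length `g` above `f j₀` contained a value,
    -- choosing one index per interval would exhaust `ι`; but `j₀` lies in none of them.
    by_contra! hcon
    choose a ha hb using hcon
    have hinj : Function.Injective a := by
      have key : ∀ k l, a k = a l → ¬ k < l := by
        intro k l hkl hlt
        have h1 : ((k : ℕ) : ℝ) + 1 ≤ (l : ℕ) := by exact_mod_cast hlt
        have h2 := hb k
        have h3 := ha l
        rw [← hkl] at h3
        nlinarith [mul_le_mul_of_nonneg_right h1 hg]
      intro k l hkl
      rcases lt_trichotomy k l with h | h | h
      · exact absurd h (key k l hkl)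
      · exact h
      · exact absurd h (key l k hkl.symm)
    have hsurj : Function.Surjective a :=
      ((Fintype.bijective_iff_injective_and_card a).2 ⟨hinj, by simp⟩).2
    obtain ⟨k, hk⟩ := hsurj j₀
    have h1 := ha k
    rw [hk] at h1
    have : 0 ≤ ((k : ℕ) : ℝ) * g := by positivity
    linarith
  obtain ⟨k, hk⟩ := hex
  refine ⟨{i | f j₀ + k * g < f i}, ?_, ?_, ?_⟩
  · have h1 : ((k : ℕ) : ℝ) ≤ Fintype.card ι := by exact_mod_cast k.2.le
    have := mul_le_mul_of_nonneg_right h1 hg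
    simp only [Set.mem_ofPred_eq]
    linarith
  · have : 0 ≤ ((k : ℕ) : ℝ) * g := by positivity
    simp only [Set.mem_ofPred_eq]
    linarith
  · intro i hi j hj
    have h1 := hk i hi
    simp only [Set.mem_ofPred_eq, not_lt] at hj
    linarith

/-- The partition `R`, refined by the set `T`. -/
def splitBy {ι : Type*} (R : Setoid ι) (T : Set ι) : Setoid ι where
  r i j := R i j ∧ (i ∈ T ↔ j ∈ T)
  iseqv := ⟨fun i => ⟨R.refl i, Iff.rfl⟩, fun h => ⟨R.symm h.1, h.2.symm⟩,
    fun h h' => ⟨R.trans h.1 h'.1, h.2.trans h'.2⟩⟩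

theorem splitBy_iff {ι : Type*} (R : Setoid ι) (T : Set ι) (i j : ι) :
    splitBy R T i j ↔ R i j ∧ (i ∈ T ↔ j ∈ T) := Iff.rfl

/-- The number of related pairs, which is large for coarse partitions. -/
noncomputable def pairCount {ι : Type*} (R : Setoid ι) : ℕ :=
  {p : ι × ι | R p.1 p.2}.ncard

theorem pairCount_splitBy_lt {ι : Type*} [Finite ι] (R : Setoid ι) (T : Set ι) {i j : ι}
    (h : R i j) (hi : i ∈ T) (hj : j ∉ T) : pairCount (splitBy R T) < pairCount R := by
  apply Set.ncard_lt_ncard _ (Set.toFinite _)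
  rw [Set.ssubset_iff_exists]
  refine ⟨fun p hp => ((splitBy_iff R T _ _).1 hp).1, (i, j), h, fun hp => ?_⟩
  exact hj ((((splitBy_iff R T _ _).1 hp).2).1 hi)

/-- All links in the slots `s ≤ u < t` are inside the blocks of `R`. -/
def ClosedOn {ι : Type*} (L : ℕ → ι → ι → Prop) (R : Setoid ι) (s t : ℕ) : Prop :=
  ∀ u, s ≤ u → u < t → ∀ i j, L u i j → R i j

theorem ClosedOn.mono {ι : Type*} {L : ℕ → ι → ι → Prop} {R : Setoid ι} {s t s' t' : ℕ}
    (h : ClosedOn L R s t) (hs : s ≤ s') (ht : t' ≤ t) : ClosedOn L R s' t' :=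
  fun u h1 h2 => h u (hs.trans h1) (h2.trans_le ht)

/-! ### Boundedness of the potential by induction over partitions -/

section

variable {ι : Type*} [Fintype ι] {o : ι} {C c : ℝ} {x : ℕ → ι → ℝ} {w Φ : ℕ → ℝ}
  {L : ℕ → ι → ι → Prop}

/-- On intervals that are closed for one of the partitions `R` with at most `k` related pairs, the
potential grows by at most `B`, and positions are stable where it does not fall by more than `K`. -/
def StableAt (o : ι) (C c : ℝ) (k : ℕ) (B : ℝ) (M : ℝ → ℝ) : Prop :=
  ∀ (x : ℕ → ι → ℝ) (w Φ : ℕ → ℝ) (L : ℕ → ι → ι → Prop), LinkedDrift o C c x w Φ L →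
    ∀ R : Setoid ι, pairCount R ≤ k → ∀ s t, s ≤ t → ClosedOn L R s t →
      Φ t ≤ Φ s + B ∧ ∀ K, Φ s - K ≤ Φ t → ∀ i, |x t i - x s i| ≤ M K

theorem LinkedDrift.conserve_on (H : LinkedDrift o C c x w Φ L) {R : Setoid ι} {s t : ℕ}
    (hst : s ≤ t) (hR : ClosedOn L R s t) (m : ι → ℝ) (h0 : m o = 0)
    (hm : ∀ i j, R i j → m i = m j) : ∑ i, m i * x t i = ∑ i, m i * x s i := by
  induction t, hst using Nat.le_induction with
  | base => rfl
  | succ t hst ih =>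
    rw [H.conserve t m h0 fun i j hij => hm i j (hR t hst t.lt_succ_self i j hij)]
    exact ih (hR.mono le_rfl t.le_succ)

/-- Blocks of diameter at most `D` at two times have moved by at most `2 * D`. -/
theorem LinkedDrift.abs_sub_le_of_small (H : LinkedDrift o C c x w Φ L) {R : Setoid ι} {s t : ℕ}
    (hst : s ≤ t) (hR : ClosedOn L R s t) {D : ℝ}
    (hs : ∀ i j, R i j → x s i - x s j ≤ D) (ht : ∀ i j, R i j → x t i - x t j ≤ D) (i : ι) :
    |x t i - x s i| ≤ 2 * D := by
  classical
  -- The block of `o` is pinned near level `0`. In any other block the sum is conserved, so its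
  -- entries cannot all move in the same direction.
  by_cases ho : R i o
  · have h1 := hs i o ho
    have h2 := hs o i (R.symm ho)
    have h3 := ht i o ho
    have h4 := ht o i (R.symm ho)
    rw [H.base] at h1 h2 h3 h4
    rw [abs_le]
    constructor <;> linarith
  · have hsum := H.conserve_on hst hR (fun j => if R i j then 1 else 0) (by simp [ho])
      (fun j k hjk => by
        have : R i j ↔ R i k := ⟨fun h => R.trans h hjk, fun h => R.trans h (R.symm hjk)⟩
        simp [this])
    have hlt : ∀ y z : ι → ℝ, (∀ i j, R i j → y i - y j ≤ D) → (∀ i j, R i j → z i - z j ≤ D) →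
        2 * D < y i - z i →
        ∑ j, (if R i j then (1 : ℝ) else 0) * z j < ∑ j, (if R i j then (1 : ℝ) else 0) * y j := by
      intro y z hy hz hyz
      have key : ∀ j, R i j → z j < y j := by
        intro j hj
        have h1 := hy i j hj
        have h2 := hz j i (R.symm hj)
        linarith
      refine Finset.sum_lt_sum (fun j _ => ?_) ⟨i, mem_univ i, ?_⟩
      · by_cases hj : R i j
        · simpa [hj] using (key j hj).le
        · simp [hj]
      · simpa using key i (R.refl i)
    rw [abs_le]
    constructor
    · by_contra! hcon
      exact absurd hsum (hlt (x s) (x t) hs ht (by linarith)).ne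
    · by_contra! hcon
      exact absurd hsum (hlt (x t) (x s) ht hs (by linarith)).ne'

/-- Given its block sums, a vector that is nearly constant on blocks nearly minimizes the sum of
squares. The proof expands around a blockwise constant `m` close to `x t`; the cross terms with `m`
agree at both times by conservation. -/
theorem LinkedDrift.sum_sq_le_of_small (H : LinkedDrift o C c x w Φ L) {R : Setoid ι} {s t : ℕ}
    (hst : s ≤ t) (hR : ClosedOn L R s t) {D : ℝ}
    (ht : ∀ i j, R i j → x t i - x t j ≤ D) :
    ∑ i, x t i ^ 2 ≤ ∑ i, x s i ^ 2 + Fintype.card ι * D ^ 2 := by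
  classical
  -- The value at a representative of the block, except that the block of `o` gets `0`, as
  -- conservation requires.
  let m : ι → ℝ := fun i => if R i o then 0 else x t (Quotient.out (Quotient.mk R i))
  have hout : ∀ i, R i (Quotient.out (Quotient.mk R i)) :=
    fun i => R.symm (Quotient.mk_out (s := R) i)
  have hm0 : m o = 0 := by simp [m]
  have hm : ∀ i j, R i j → m i = m j := by
    intro i j hij
    have h1 : R i o ↔ R j o := ⟨fun h => R.trans (R.symm hij) h, fun h => R.trans hij h⟩
    have h2 : Quotient.mk R i = Quotient.mk R j := Quotient.sound hij
    simp only [m, h1, h2]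
  have hmD : ∀ i, (x t i - m i) ^ 2 ≤ D ^ 2 := by
    intro i
    have : |x t i - m i| ≤ D := by
      rw [abs_le]
      by_cases ho : R i o
      · have h3 := ht i o ho
        have h4 := ht o i (R.symm ho)
        rw [H.base] at h3 h4
        simp only [m, ho, if_true]
        constructor <;> linarith
      · have h3 := ht _ _ (hout i)
        have h4 := ht _ _ (R.symm (hout i))
        simp only [m, ho, if_false]
        constructor <;> linarith
    exact sq_le_sq' (abs_le.1 this).1 (abs_le.1 this).2
  have hsum := H.conserve_on hst hR m hm0 hm
  have hterm : ∀ i, x t i ^ 2 ≤ x s i ^ 2 + D ^ 2 + 2 * (m i * x t i - m i * x s i) := by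
    intro i
    nlinarith [hmD i, sq_nonneg (x s i - m i)]
  calc ∑ i, x t i ^ 2
      ≤ ∑ i, (x s i ^ 2 + D ^ 2 + 2 * (m i * x t i - m i * x s i)) :=
        Finset.sum_le_sum fun i _ => hterm i
    _ = ∑ i, x s i ^ 2 + Fintype.card ι * D ^ 2 := by
        rw [Finset.sum_add_distrib, Finset.sum_add_distrib, ← Finset.mul_sum,
          Finset.sum_sub_distrib, hsum]
        simp

/-- While `w` exceeds `C / c` the potential does not grow. At the first slot where `w` is at most `C
/ c`, the potential is within a constant of the sum of squares, which is nearly minimal at time `t`.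
-/
theorem LinkedDrift.potential_le_of_small (H : LinkedDrift o C c x w Φ L) (hc : 0 < c)
    (hC : 0 ≤ C) {R : Setoid ι} {s t : ℕ} (hst : s ≤ t) (hR : ClosedOn L R s t) {D : ℝ}
    (ht : ∀ i j, R i j → x t i - x t j ≤ D) :
    Φ t ≤ Φ s + (C * (1 + C / c) + Fintype.card ι * D ^ 2) := by
  have hB : 0 ≤ C * (1 + C / c) + Fintype.card ι * D ^ 2 := by positivity
  induction hst using Nat.decreasingInduction with
  | self => linarith
  | of_succ s hst ih =>
    by_cases hw : w s ≤ C / c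
    · have h1 := H.le_sq t
      have h2 := H.sum_sq_le_of_small (Nat.le_of_lt hst) hR ht
      have h3 := H.sq_le s
      have h4 : C * (1 + w s) ≤ C * (1 + C / c) := by gcongr
      linarith
    · push Not at hw
      have h1 := H.drift s
      rw [div_lt_iff₀ hc] at hw
      have h2 := ih (hR.mono s.le_succ le_rfl)
      linarith

/-- As long as some block has a large diameter, the potential grows by at most as much as for
finer partitions, and positions are stable as long as it does not fall much. -/
theorem LinkedDrift.of_spread (H : LinkedDrift o C c x w Φ L) {k : ℕ} {B G : ℝ} {M : ℝ → ℝ}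
    (hk : StableAt o C c k B M) (hc : 0 < c) (hC : 0 ≤ C) (hB : 0 ≤ B) (hM : ∀ K, 0 ≤ M K)
    (hG0 : 0 ≤ G)
    (hG : C + B + 1 ≤ c * G) (hGM : 2 * M 1 ≤ G) {R : Setoid ι} (hRk : pairCount R ≤ k + 1)
    (n : ℕ) : ∀ s, ClosedOn L R s (s + n) →
    (∀ u, s ≤ u → u < s + n → ∃ i j, R i j ∧ x u j + Fintype.card ι * (2 * G) < x u i) →
    Φ (s + n) ≤ Φ s + B ∧ ∀ K, Φ s - K + B ≤ Φ (s + n) → ∀ i,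
      |x (s + n) i - x s i| ≤ (M K + C) * (1 + Φ s - Φ (s + n) + B) := by
  classical
  induction n using Nat.strong_induction_on with
  | _ n ih =>
  intro s hR hD
  rcases Nat.eq_zero_or_pos n with rfl | hn
  · refine ⟨by simpa using hB, fun K _ i => ?_⟩
    have := hM K
    simp only [add_zero, sub_self, abs_zero]
    have : 0 ≤ 1 + Φ s - Φ s + B := by linarith
    positivity
  obtain ⟨i₀, j₀, hij, hlt⟩ := hD s le_rfl (by omega)
  obtain ⟨T, hiT, hjT, hT⟩ := exists_gap (x s) (by linarith : (0 : ℝ) ≤ 2 * G) hlt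
  have hR' : pairCount (splitBy R T) ≤ k := by
    have := pairCount_splitBy_lt R T hij hiT hjT
    omega
  -- the first slot in which the gap has shrunk or there is a link across it
  let bad : ℕ → Prop := fun a => a = n ∨ (∃ i ∈ T, ∃ j ∉ T, x (s + a) i - x (s + a) j < G) ∨
    ∃ i j, L (s + a) i j ∧ ¬ splitBy R T i j
  have hbad : ∃ a, bad a := ⟨n, Or.inl rfl⟩
  obtain ⟨a, ha, hmin⟩ : ∃ a, bad a ∧ ∀ b < a, ¬ bad b :=
    ⟨Nat.find hbad, Nat.find_spec hbad, fun b hb => Nat.find_min hbad hb⟩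
  have han : a ≤ n := by
    by_contra! h
    exact hmin n h (Or.inl rfl)
  have hcl : ClosedOn L (splitBy R T) s (s + a) := by
    intro u hu hua i j hij
    by_contra hcon
    obtain ⟨b, rfl⟩ := Nat.exists_eq_add_of_le hu
    exact hmin b (by omega) (Or.inr (Or.inr ⟨i, j, hij, hcon⟩))
  obtain ⟨hfine, hpos⟩ := hk x w Φ L H _ hR' s (s + a) (by omega) hcl
  -- restarting after a drop by one
  have restart : ∀ b, 0 < b → b ≤ n → Φ (s + b) ≤ Φ s - 1 →
      (∀ K, Φ s - K ≤ Φ (s + b) → ∀ i, |x (s + b) i - x s i| ≤ M K + C) →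
      Φ (s + n) ≤ Φ s + B ∧ ∀ K, Φ s - K + B ≤ Φ (s + n) → ∀ i,
      |x (s + n) i - x s i| ≤ (M K + C) * (1 + Φ s - Φ (s + n) + B) := by
    intro b hb hbn hdrop hmove
    have hsum : s + b + (n - b) = s + n := by omega
    obtain ⟨h1, h2⟩ := ih (n - b) (by omega) (s + b)
      (by rw [hsum]; exact hR.mono (by omega) le_rfl)
      (by rw [hsum]; exact fun u hu hu' => hD u (by omega) hu')
    rw [hsum] at h1 h2
    refine ⟨by linarith, fun K hK i => ?_⟩
    have h3 := h2 K (by linarith) i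
    have h4 := hmove K (by linarith) i
    have h5 : |x (s + n) i - x s i| ≤ |x (s + n) i - x (s + b) i| + |x (s + b) i - x s i| :=
      abs_sub_le _ _ _
    have h6 : 0 ≤ M K + C := by linarith [hM K]
    nlinarith [mul_le_mul_of_nonneg_left hdrop h6]
  by_cases hgap : ∃ i ∈ T, ∃ j ∉ T, x (s + a) i - x (s + a) j < G
  · obtain ⟨i, hi, j, hj, hlt'⟩ := hgap
    have h0 := hT i hi j hj
    have ha0 : 0 < a := by
      rcases Nat.eq_zero_or_pos a with rfl | h
      · rw [add_zero] at hlt'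
        linarith
      · exact h
    refine restart a ha0 han ?_ fun K hK i => (hpos K hK i).trans (by linarith)
    -- Without a drop by one, stability with `K = 1` moves both ends by at most `M 1`, so the gap
    -- shrinks by at most `2 * M 1 ≤ G` and remains at least `G`.
    by_contra! hcon
    have h1 := abs_le.1 (hpos 1 hcon.le i)
    have h2 := abs_le.1 (hpos 1 hcon.le j)
    linarith
  push Not at hgap
  by_cases hlink : a < n ∧ ∃ i j, L (s + a) i j ∧ ¬ splitBy R T i j
  · obtain ⟨han', i, j, hL, hnot⟩ := hlink
    have hRij := hR (s + a) (by omega) (by omega) i j hL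
    -- A link across the gap costs `c * G ≥ C + B + 1`, which outweighs the growth `B` so far and
    -- the error `C` of this slot.
    have hw : G ≤ w (s + a) := by
      refine le_trans ?_ (H.link_le _ i j hL)
      rw [splitBy_iff] at hnot
      by_cases hi : i ∈ T
      · exact (hgap i hi j (by tauto)).trans (le_abs_self _)
      · rw [abs_sub_comm]
        exact (hgap j (by tauto) i hi).trans (le_abs_self _)
    have hd := H.drift (s + a)
    have hcw := mul_le_mul_of_nonneg_left hw hc.le
    refine restart (a + 1) (by omega) han' ?_ fun K hK l => ?_
    · rw [← add_assoc]
      linarith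
    · rw [← add_assoc] at hK ⊢
      have h1 := hpos K (by linarith) l
      have h2 := H.step_le (s + a) l
      have h3 := abs_sub_le (x (s + a + 1) l) (x (s + a) l) (x s l)
      linarith
  · have hana : a = n := by
      rcases ha with h | h | h
      · exact h
      · obtain ⟨i, hi, j, hj, h⟩ := h
        exact absurd (hgap i hi j hj) (not_le.2 h)
      · by_contra hne
        exact hlink ⟨by omega, h⟩
    subst hana
    refine ⟨hfine, fun K hK i => ?_⟩
    have h1 := hpos K (by linarith) i
    have h2 := hM K
    nlinarith

/-- Time splits at the slots where all blocks have diameter at most `D`. Up to the last such slot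
the growth is controlled by near-minimality, and after it by `of_spread`. Positions drift by `Y K`
before the first such slot, by `2 * D` between the first and the last, by `C` in one step, and by `Y
K` afterwards. -/
theorem stableAt_succ {k : ℕ} {B : ℝ} {M : ℝ → ℝ} (hc : 0 < c) (hC : 0 ≤ C) (hB : 0 ≤ B)
    (hM : ∀ K, 0 ≤ M K) (hk : StableAt o C c k B M) :
    ∃ (B' : ℝ) (M' : ℝ → ℝ), 0 ≤ B' ∧ (∀ K, 0 ≤ M' K) ∧ StableAt o C c (k + 1) B' M' := by
  classical
  obtain ⟨G, hG0, hG, hGM⟩ : ∃ G : ℝ, 0 ≤ G ∧ C + B + 1 ≤ c * G ∧ 2 * M 1 ≤ G := by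
    refine ⟨(C + B + 1) / c + 2 * M 1, ?_, ?_, ?_⟩
    · have := hM 1
      positivity
    · rw [mul_add, mul_div_cancel₀ _ hc.ne']
      have := mul_nonneg hc.le (hM 1)
      linarith
    · have : 0 ≤ (C + B + 1) / c := by positivity
      linarith
  let D : ℝ := Fintype.card ι * (2 * G)
  have hD : 0 ≤ D := by positivity
  let B₁ : ℝ := C * (1 + C / c) + Fintype.card ι * D ^ 2
  have hB₁ : 0 ≤ B₁ := by positivity
  let B' : ℝ := B₁ + C + B
  have hB' : B ≤ B' := by linarith
  let Y : ℝ → ℝ := fun K => (M (K + B' + B) + C) * (1 + |K + B'| + B)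
  have hY : ∀ K, 0 ≤ Y K := fun K => by
    have := hM (K + B' + B)
    positivity
  refine ⟨B', fun K => Y K + 2 * D + C + Y K, by linarith,
    fun K => by linarith [hY K], ?_⟩
  intro x w Φ L H R hRk s t hst hR
  -- The threshold is `K + B'` rather than `K` because this is applied to subintervals: growth by at
  -- most `B'` outside them leaves a drop of at most `K + B'` inside.
  have esc : ∀ u v, s ≤ u → u ≤ v → v ≤ t →
      (∀ u', u ≤ u' → u' < v → ¬ ∀ i j, R i j → x u' i - x u' j ≤ D) →
      Φ v ≤ Φ u + B ∧ ∀ K, Φ u - (K + B') ≤ Φ v → ∀ i, |x v i - x u i| ≤ Y K := by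
    intro u v hsu huv hvt hns
    obtain ⟨n, rfl⟩ := Nat.exists_eq_add_of_le huv
    have h := H.of_spread hk hc hC hB hM hG0 hG hGM hRk n u (hR.mono hsu hvt) (by
      intro u' h1 h2
      have := hns u' h1 h2
      push Not at this
      obtain ⟨i, j, hij, hlt⟩ := this
      exact ⟨i, j, hij, by linarith⟩)
    refine ⟨h.1, fun K hK i => (h.2 (K + B' + B) (by linarith) i).trans ?_⟩
    have h2 : 0 ≤ M (K + B' + B) + C := by linarith [hM (K + B' + B)]
    refine mul_le_mul_of_nonneg_left ?_ h2
    have := le_abs_self (K + B')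
    linarith
  have growth : ∀ u v, s ≤ u → u ≤ v → v ≤ t → Φ v ≤ Φ u + B' := by
    intro u v hsu huv hvt
    induction v, huv using Nat.le_induction with
    | base => linarith
    | succ v huv ih =>
      by_cases hsm : ∃ a, u ≤ a ∧ a < v + 1 ∧ ∀ i j, R i j → x a i - x a j ≤ D
      · let P : ℕ → Prop := fun a => u ≤ a ∧ ∀ i j, R i j → x a i - x a j ≤ D
        obtain ⟨a₀, h1, h2, h3⟩ := hsm
        have hspec : P (Nat.findGreatest P v) := Nat.findGreatest_spec (P := P)
          (Nat.lt_succ_iff.1 h2) ⟨h1, h3⟩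
        set a := Nat.findGreatest P v with ha
        have hav : a ≤ v := Nat.findGreatest_le v
        have h4 := H.potential_le_of_small hc hC hspec.1
          (hR.mono hsu (by omega)) hspec.2
        have h5 := (esc (a + 1) (v + 1) (by linarith [hspec.1]) (by omega) hvt (by
          intro u' hu1 hu2 hsmall
          exact Nat.findGreatest_is_greatest (P := P) (n := v) (k := u') (by omega) (by omega)
            ⟨by linarith [hspec.1], hsmall⟩)).1
        have h6 := H.drift a
        have h7 := mul_nonneg hc.le (H.w_nonneg a)
        simp only [B', B₁]
        linarith
      · push Not at hsm
        have := (esc u (v + 1) hsu (by omega) hvt (fun u' h1 h2 hall => by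
          obtain ⟨i, j, hij, hlt⟩ := hsm u' h1 h2
          linarith [hall i j hij])).1
        linarith
  refine ⟨growth s t le_rfl hst le_rfl, fun K hK i => ?_⟩
  by_cases hsm : ∃ a, s ≤ a ∧ a < t ∧ ∀ i j, R i j → x a i - x a j ≤ D
  · let P : ℕ → Prop := fun a => s ≤ a ∧ a < t ∧ ∀ i j, R i j → x a i - x a j ≤ D
    have hfirst : P (Nat.find hsm) := Nat.find_spec hsm
    have hmin : ∀ b, b < Nat.find hsm → ¬ P b := fun b hb => Nat.find_min hsm hb
    set a := Nat.find hsm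
    have hlast : P (Nat.findGreatest P t) := Nat.findGreatest_spec (P := P) hfirst.2.1.le hfirst
    have hab : a ≤ Nat.findGreatest P t := Nat.le_findGreatest hfirst.2.1.le hfirst
    have hmax : ∀ b, Nat.findGreatest P t < b → b ≤ t → ¬ P b :=
      fun b h1 h2 => Nat.findGreatest_is_greatest h1 h2
    set b := Nat.findGreatest P t
    have hbt : b < t := hlast.2.1
    have h1 := (esc s a le_rfl hfirst.1 hfirst.2.1.le
      (fun u' h1 h2 h3 => hmin u' h2 ⟨h1, by linarith [hfirst.2.1], h3⟩)).2 K
      (by linarith [growth a t hfirst.1 hfirst.2.1.le le_rfl]) i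
    have h2 := H.abs_sub_le_of_small hab (hR.mono hfirst.1 hbt.le) hfirst.2.2 hlast.2.2 i
    have h3 := H.step_le b i
    have h4 := (esc (b + 1) t (by linarith [hlast.1]) hbt le_rfl
      (fun u' h1 h2 h3 => hmax u' (by omega) h2.le ⟨by linarith [hlast.1], h2, h3⟩)).2 K
      (by linarith [growth s (b + 1) le_rfl (by linarith [hlast.1]) hbt]) i
    rw [abs_le] at *
    constructor <;> linarith
  · push Not at hsm
    have := (esc s t le_rfl hst le_rfl (fun u' h1 h2 hall => by
      obtain ⟨i, j, hij, hlt⟩ := hsm u' h1 h2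
      linarith [hall i j hij])).2 K (by linarith) i
    linarith [hY K]

theorem exists_stableAt (o : ι) (hc : 0 < c) (hC : 0 ≤ C) (k : ℕ) :
    ∃ (B : ℝ) (M : ℝ → ℝ), 0 ≤ B ∧ (∀ K, 0 ≤ M K) ∧ StableAt o C c k B M := by
  induction k with
  | zero =>
    -- This case is vacuous, as the pair `(o, o)` is always related.
    refine ⟨0, fun _ => 0, le_rfl, fun _ => le_rfl, fun x w Φ L _ R hR => ?_⟩
    rw [Nat.le_zero, pairCount, Set.ncard_eq_zero (Set.toFinite _)] at hR
    exact absurd (show (o, o) ∈ {p : ι × ι | R p.1 p.2} from R.refl o) (by simp [hR])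
  | succ k ih =>
    obtain ⟨B, M, hB, hM, hk⟩ := ih
    exact stableAt_succ hc hC hB hM hk

theorem LinkedDrift.exists_potential_le (o : ι) (hc : 0 < c) (hC : 0 ≤ C) :
    ∃ B : ℝ, ∀ (x : ℕ → ι → ℝ) (w Φ : ℕ → ℝ) (L : ℕ → ι → ι → Prop),
      LinkedDrift o C c x w Φ L → ∀ t, Φ t ≤ Φ 0 + B := by
  obtain ⟨B, M, -, -, h⟩ := exists_stableAt o hc hC (pairCount (⊤ : Setoid ι))
  exact ⟨B, fun x w Φ L H t => (h x w Φ L H ⊤ le_rfl 0 t t.zero_le fun _ _ _ _ _ _ => trivial).1⟩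

end

/-! ### One slot of Max-Weight -/

section

variable {V E D : Type*} [Fintype V] [Fintype E] [Fintype D] [DecidableEq V] [DecidableEq D]

namespace Network

/-- The largest queue differential of `e` over all destinations, or `0` if all are negative. -/
noncomputable def pressure (N : Network V E D) (q : V → D → ℝ) (e : E) : ℝ :=
  ⨆ d : D, max (N.diff q e d) 0

omit [Fintype V] [Fintype E] [Fintype D] [DecidableEq V] [DecidableEq D] in
theorem pressure_nonneg (N : Network V E D) (q : V → D → ℝ) (e : E) : 0 ≤ N.pressure q e :=
  Real.iSup_nonneg fun _ => le_max_right _ _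

omit [Fintype V] [Fintype E] [DecidableEq V] [DecidableEq D] in
theorem diff_le_pressure (N : Network V E D) (q : V → D → ℝ) (e : E) (d : D) :
    N.diff q e d ≤ N.pressure q e :=
  (le_max_left _ 0).trans (le_ciSup (f := fun d => max (N.diff q e d) 0)
    (Set.finite_range _).bddAbove d)

omit [Fintype V] [Fintype E] [Fintype D] [DecidableEq V] [DecidableEq D] in
theorem pressure_le (N : Network V E D) {q : V → D → ℝ} {e : E} {b : ℝ} (hb : 0 ≤ b)
    (h : ∀ d, N.diff q e d ≤ b) : N.pressure q e ≤ b :=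
  Real.iSup_le (fun d => max_le (h d) hb) hb

omit [Fintype V] [Fintype E] [DecidableEq V] [DecidableEq D] in
theorem pressure_le_add (N : Network V E D) {q q' : V → D → ℝ} {b : ℝ} (hb : 0 ≤ b)
    (h : ∀ v d, |q v d - q' v d| ≤ b) (e : E) : N.pressure q e ≤ N.pressure q' e + 2 * b := by
  refine N.pressure_le (by linarith [N.pressure_nonneg q' e]) fun d => ?_
  have h1 := abs_le.1 (h (N.tail e) d)
  have h2 := abs_le.1 (h (N.head e) d)
  have h3 := N.diff_le_pressure q' e d
  unfold diff at *
  linarith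

omit [Fintype V] [Fintype D] [DecidableEq V] [DecidableEq D] [Fintype E] in
theorem sent_nonneg (N : Network V E D) {q : V → D → ℝ} {r : E → ℝ} {δ : E → D} {e : E}
    (hr : 0 ≤ r e) : 0 ≤ N.sent q r δ e :=
  le_min hr (abs_nonneg _)

section

variable {N : Network V E D} {R : Set (E → ℝ)} {q : V → D → ℝ} {r : E → ℝ} {δ : E → D}

omit [Fintype V] [Fintype D] [DecidableEq V] [DecidableEq D] in
/-- Changing the rate of a single edge does not increase the weight of that edge. -/
theorem IsMaxWeightChoice.term_le (h : N.IsMaxWeightChoice R q r δ) (e : E) {y : ℝ} (hy : 0 ≤ y)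
    {r' : E → ℝ} (hr' : r' ∈ R) (hle : ∀ e', r e' ≤ r' e') (hye : y ≤ r' e) :
    min y |N.diff q e (δ e) / 2| * N.diff q e (δ e) ≤ N.sent q r δ e * N.diff q e (δ e) := by
  classical
  have hmem : Function.update r e y ∈ downClosure R := by
    refine ⟨fun e' => ?_, r', hr', fun e' => ?_⟩ <;> by_cases he : e' = e
    · subst he; simpa using hy
    · simpa [he] using h.1.1 e'
    · subst he; simpa using hye
    · simpa [he] using hle e'
  have hw := h.2 _ hmem δ
  unfold weight at hw
  rw [← Finset.add_sum_erase _ _ (mem_univ e), ← Finset.add_sum_erase _ _ (mem_univ e)] at hw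
  have hsum : ∑ e' ∈ univ.erase e, N.sent q (Function.update r e y) δ e' * N.diff q e' (δ e') =
      ∑ e' ∈ univ.erase e, N.sent q r δ e' * N.diff q e' (δ e') := by
    refine Finset.sum_congr rfl fun e' he' => ?_
    simp [sent, (Finset.mem_erase.1 he').1]
  rw [hsum] at hw
  have hw' := le_of_add_le_add_right hw
  simpa only [sent, Function.update_self] using hw'

omit [Fintype V] [Fintype D] [DecidableEq V] [DecidableEq D] in
theorem IsMaxWeightChoice.term_nonneg (h : N.IsMaxWeightChoice R q r δ) (e : E) :
    0 ≤ N.sent q r δ e * N.diff q e (δ e) := by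
  obtain ⟨r', hr', hle⟩ := h.1.2
  simpa using h.term_le e le_rfl hr' hle ((h.1.1 e).trans (hle e))

-- Data only moves strictly downhill: no term of an optimal choice is negative, and a zero
-- differential caps the amount sent at `0`.
omit [Fintype V] [Fintype D] [DecidableEq V] [DecidableEq D] in
theorem IsMaxWeightChoice.diff_pos (h : N.IsMaxWeightChoice R q r δ) {e : E}
    (he : 0 < N.sent q r δ e) : 0 < N.diff q e (δ e) := by
  have h1 : 0 ≤ N.diff q e (δ e) := nonneg_of_mul_nonneg_right (h.term_nonneg e) he
  refine lt_of_le_of_ne h1 fun h0 => ?_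
  have : N.sent q r δ e ≤ |N.diff q e (δ e) / 2| := min_le_right _ _
  rw [← h0] at this
  simp at this
  linarith

omit [Fintype V] [Fintype D] [DecidableEq V] [DecidableEq D] in
theorem IsMaxWeightChoice.term_le_weight (h : N.IsMaxWeightChoice R q r δ) (e : E) :
    N.sent q r δ e * N.diff q e (δ e) ≤ N.weight q r δ :=
  Finset.single_le_sum (f := fun e => N.sent q r δ e * N.diff q e (δ e))
    (fun e _ => h.term_nonneg e) (mem_univ e)

omit [Fintype V] [Fintype D] [DecidableEq V] [DecidableEq D] in
theorem IsMaxWeightChoice.weight_nonneg (h : N.IsMaxWeightChoice R q r δ) :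
    0 ≤ N.weight q r δ :=
  Finset.sum_nonneg fun e _ => h.term_nonneg e

omit [Fintype V] [Fintype D] [DecidableEq V] [DecidableEq D] in
/-- An edge with a large differential is used at its full rate. -/
theorem IsMaxWeightChoice.diff_le (h : N.IsMaxWeightChoice R q r δ) {Rmin : ℝ} (hRmin : 0 < Rmin)
    (hR : ∀ ρ ∈ R, ∀ e, ρ e ≠ 0 → Rmin ≤ ρ e) {e : E} (he : 0 < N.sent q r δ e) :
    |N.diff q e (δ e)| ≤ 1 + (1 / Rmin + 1) * N.weight q r δ := by
  obtain ⟨r', hr', hle⟩ := h.1.2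
  have hd := h.diff_pos he
  have hre : 0 < r' e := he.trans_le ((min_le_left _ _).trans (hle e))
  -- Raising the rate of `e` to `r' e ≥ Rmin` gains nothing, so the optimal term already has size at
  -- least `Rmin` times the differential or half its square.
  have h1 := h.term_le e hre.le hr' hle le_rfl
  have h2 := le_of_mul_le_mul_right h1 hd
  have h3 := hR r' hr' e hre.ne'
  have h4 := h.term_le_weight e
  have h5 : Rmin * N.diff q e (δ e) ≤ N.weight q r δ ∨
      N.diff q e (δ e) / 2 * N.diff q e (δ e) ≤ N.weight q r δ := by
    rw [abs_of_pos (half_pos hd)] at h2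
    rcases min_le_iff.1 h2 with h5 | h5
    · exact Or.inl ((mul_le_mul_of_nonneg_right (h3.trans h5) hd.le).trans h4)
    · exact Or.inr ((mul_le_mul_of_nonneg_right h5 hd.le).trans h4)
  have hw := h.weight_nonneg
  rw [abs_of_pos hd]
  have hexp : (1 / Rmin + 1) * N.weight q r δ = N.weight q r δ / Rmin + N.weight q r δ := by ring
  have hwR : 0 ≤ N.weight q r δ / Rmin := by positivity
  rw [hexp]
  rcases h5 with h5 | h5
  · have : N.diff q e (δ e) ≤ N.weight q r δ / Rmin := by
      rw [le_div_iff₀ hRmin]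
      linarith
    linarith
  · nlinarith [sq_nonneg (N.diff q e (δ e) - 1)]

omit [Fintype V] [DecidableEq V] [DecidableEq D] in
/-- Max-Weight does nearly as well as any feasible rates with the best destinations. -/
theorem IsMaxWeightChoice.sum_pressure_le (h : N.IsMaxWeightChoice R q r δ) {Rmin Rmax : ℝ}
    (hRmin : 0 < Rmin) (hge : ∀ ρ ∈ R, ∀ e, ρ e ≠ 0 → Rmin ≤ ρ e)
    (hle : ∀ ρ ∈ R, ∀ e, ρ e ≤ Rmax) {ρ : E → ℝ} (hρ : ρ ∈ R) :
    ∑ e, ρ e * N.pressure q e ≤ N.weight q r δ + Fintype.card E * (2 * Rmax ^ 2) := by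
  have hρ0 : ∀ e, 0 ≤ ρ e := fun e => by
    by_cases h0 : ρ e = 0
    · exact h0.ge
    · exact hRmin.le.trans (hge ρ hρ e h0)
  have hbest : ∀ e, ∃ d, N.pressure q e = max (N.diff q e d) 0 := fun e => by
    have : Nonempty D := ⟨δ e⟩
    obtain ⟨d, hd⟩ := exists_eq_ciSup_of_finite (f := fun d => max (N.diff q e d) 0)
    exact ⟨d, hd.symm⟩
  choose δ' hδ' using hbest
  -- Edges without a positive differential are switched off, which the downward closure permits.
  let r' : E → ℝ := fun e => if 0 < N.diff q e (δ' e) then ρ e else 0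
  have hr' : r' ∈ downClosure R := by
    refine ⟨fun e => ?_, ρ, hρ, fun e => ?_⟩ <;> by_cases hd : 0 < N.diff q e (δ' e) <;>
      simp [r', hd, hρ0 e]
  have hterm : ∀ e, ρ e * N.pressure q e ≤
      N.sent q r' δ' e * N.diff q e (δ' e) + 2 * Rmax ^ 2 := by
    intro e
    rw [hδ' e]
    have h0 := hρ0 e
    have h1 := hle ρ hρ e
    by_cases hd : 0 < N.diff q e (δ' e)
    · rw [max_eq_left hd.le]
      simp only [sent, r', hd, if_true, abs_of_pos (half_pos hd)]
      rcases le_total (ρ e) (N.diff q e (δ' e) / 2) with h2 | h2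
      · rw [min_eq_left h2]
        nlinarith [sq_nonneg Rmax]
      -- The cap at half the differential matters only when the differential is at most `2 * Rmax`,
      -- so it costs at most `2 * Rmax ^ 2`.
      · rw [min_eq_right h2]
        have h3 : N.diff q e (δ' e) ≤ 2 * Rmax := by linarith
        nlinarith [mul_le_mul h1 h3 hd.le (h0.trans h1), mul_pos hd hd]
    · rw [max_eq_right (not_lt.1 hd)]
      simp only [sent, r', hd, if_false]
      rw [min_eq_left (abs_nonneg (N.diff q e (δ' e) / 2))]
      nlinarith [sq_nonneg Rmax]
  calc ∑ e, ρ e * N.pressure q e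
      ≤ ∑ e, (N.sent q r' δ' e * N.diff q e (δ' e) + 2 * Rmax ^ 2) :=
        Finset.sum_le_sum fun e _ => hterm e
    _ = N.weight q r' δ' + Fintype.card E * (2 * Rmax ^ 2) := by
        rw [Finset.sum_add_distrib]
        simp [weight]
    _ ≤ _ := by linarith [h.2 r' hr' δ']

end

/-- Summation by parts for the flow `f`. -/
theorem sum_mul_net_flow (N : Network V E D) (δ : E → D) (f : E → ℝ) (m : V → D → ℝ) :
    ∑ v, ∑ d, m v d * (N.inflow δ f v d - N.outflow δ f v d) =
      -∑ e, f e * N.diff m e (δ e) := by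
  have key : ∀ g : E → V, ∑ v, ∑ d, m v d * (∑ e, if g e = v ∧ δ e = d then f e else 0) =
      ∑ e, f e * m (g e) (δ e) := by
    intro g
    simp_rw [Finset.mul_sum]
    rw [← Fintype.sum_prod_type' (f := fun v d => ∑ e, m v d * if g e = v ∧ δ e = d then f e else 0),
      Finset.sum_comm]
    refine Finset.sum_congr rfl fun e _ => ?_
    rw [Finset.sum_eq_single (g e, δ e)]
    · simp [mul_comm]
    · rintro ⟨v, d⟩ - hne
      have : ¬ (g e = v ∧ δ e = d) := fun h => hne (by rw [h.1, h.2])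
      simp [this]
    · simp
  simp_rw [mul_sub, Finset.sum_sub_distrib]
  unfold inflow outflow
  rw [key, key, ← Finset.sum_sub_distrib, ← Finset.sum_neg_distrib]
  refine Finset.sum_congr rfl fun e _ => ?_
  unfold diff
  ring

/-- The consequences of a slot of Max-Weight from `q` to `q'` that stability depends on. `W` is the
weight of the choice and `S` is the set of edges that are used, with the destinations they serve. -/
structure SlotBound (N : Network V E D) (R : Set (E → ℝ)) (a q q' : V → D → ℝ) (κ C W : ℝ)
    (S : Set (E × D)) : Prop where
  weight_nonneg : 0 ≤ W
  nonneg : ∀ v d, 0 ≤ q' v d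
  target : ∀ d, ∀ v ∈ N.target d, q' v d = 0
  step_le : ∀ v d, |q' v d - q v d| ≤ C
  diff_le : ∀ p ∈ S, |N.diff q p.1 p.2| ≤ 1 + κ * W
  conserve : ∀ m : V → D → ℝ, (∀ d, ∀ v ∈ N.target d, m v d = 0) →
    (∀ p ∈ S, N.diff m p.1 p.2 = 0) → (∀ v d, a v d ≠ 0 → m v d = 0) →
    ∑ v, ∑ d, m v d * q' v d = ∑ v, ∑ d, m v d * q v d
  sum_pressure_le : ∀ ρ ∈ R, ∑ e, ρ e * N.pressure q e ≤ W + C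
  drift : ∑ v, ∑ d, q' v d ^ 2 ≤
    ∑ v, ∑ d, q v d ^ 2 + 2 * ∑ v, ∑ d, a v d * q v d - 2 * W + C

section

variable {N : Network V E D} {R : Set (E → ℝ)} {a q q' : V → D → ℝ}

omit [Fintype V] [Fintype D] in
theorem outflow_nonneg {δ : E → D} {f : E → ℝ} (hf : ∀ e, 0 ≤ f e) (v : V) (d : D) :
    0 ≤ N.outflow δ f v d :=
  Finset.sum_nonneg fun e _ => by split_ifs <;> simp [hf]

omit [Fintype V] [Fintype D] in
theorem inflow_nonneg {δ : E → D} {f : E → ℝ} (hf : ∀ e, 0 ≤ f e) (v : V) (d : D) :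
    0 ≤ N.inflow δ f v d :=
  Finset.sum_nonneg fun e _ => by split_ifs <;> simp [hf]

omit [Fintype V] [Fintype D] in
theorem outflow_le {δ : E → D} {f : E → ℝ} {b : ℝ} (hb : 0 ≤ b) (hf : ∀ e, f e ≤ b) (v : V)
    (d : D) : N.outflow δ f v d ≤ Fintype.card E * b := by
  calc N.outflow δ f v d ≤ ∑ _e : E, b :=
        Finset.sum_le_sum fun e _ => by split_ifs <;> simp [hf, hb]
    _ = _ := by simp

omit [Fintype V] [Fintype D] in
theorem inflow_le {δ : E → D} {f : E → ℝ} {b : ℝ} (hb : 0 ≤ b) (hf : ∀ e, f e ≤ b) (v : V)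
    (d : D) : N.inflow δ f v d ≤ Fintype.card E * b := by
  calc N.inflow δ f v d ≤ ∑ _e : E, b :=
        Finset.sum_le_sum fun e _ => by split_ifs <;> simp [hf, hb]
    _ = _ := by simp

omit [Fintype V] [Fintype D] in
theorem eq_of_outflow_eq {δ : E → D} {f g : E → ℝ} (hfg : ∀ e, f e ≤ g e) {v : V} {d : D}
    (h : N.outflow δ f v d = N.outflow δ g v d) {e : E} (he : N.tail e = v) (hd : δ e = d) :
    f e = g e := by
  have := (Finset.sum_eq_sum_iff_of_le (s := univ)
    (f := fun e => if N.tail e = v ∧ δ e = d then f e else 0)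
    (g := fun e => if N.tail e = v ∧ δ e = d then g e else 0)
    (fun e _ => by split_ifs <;> simp [hfg])).1 h e (mem_univ e)
  simpa [he, hd] using this

theorem MaxWeightStep.exists_slotBound {Rmin Rmax : ℝ} (hRmin : 0 < Rmin) (hRmax : 0 < Rmax)
    (hge : ∀ ρ ∈ R, ∀ e, ρ e ≠ 0 → Rmin ≤ ρ e) (hle : ∀ ρ ∈ R, ∀ e, ρ e ≤ Rmax)
    (ha0 : ∀ v d, 0 ≤ a v d) (ha : ∀ v d, a v d ≤ Rmax) (hq : ∀ v d, 0 ≤ q v d)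
    (hqt : ∀ d, ∀ v ∈ N.target d, q v d = 0) (h : N.MaxWeightStep R a q q') :
    ∃ W S, N.SlotBound R a q q' (1 / Rmin + 1)
      ((Fintype.card E + 1) * Rmax + Fintype.card E * (2 * Rmax ^ 2) +
        2 * (Fintype.card E * (Fintype.card E * Rmax ^ 2)) +
        Fintype.card V * (Fintype.card D * ((Fintype.card E + 1) * Rmax) ^ 2)) W S := by
  obtain ⟨r, δ, f, hmw, hf, hout, hq'⟩ := h
  have hf0 : ∀ e, 0 ≤ f e := fun e => (hf e).1
  obtain ⟨r₁, hmem₁, hr₁⟩ := hmw.1.2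
  have hsR : ∀ e, N.sent q r δ e ≤ Rmax := fun e =>
    (min_le_left _ _).trans ((hr₁ e).trans (hle r₁ hmem₁ e))
  have hfR : ∀ e, f e ≤ Rmax := fun e => (hf e).2.trans (hsR e)
  set Y : ℝ := (Fintype.card E + 1) * Rmax with hY
  have hY' : Y = Fintype.card E * Rmax + Rmax := by rw [hY]; ring
  have hY0 : 0 ≤ Y := by positivity
  have hE : (0 : ℝ) ≤ Fintype.card E := Nat.cast_nonneg _
  have hX1 : 0 ≤ Fintype.card E * (2 * Rmax ^ 2) := by positivity
  have hX2 : 0 ≤ 2 * ((Fintype.card E : ℝ) * (Fintype.card E * Rmax ^ 2)) := by positivity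
  have hX3 : 0 ≤ Fintype.card V * (Fintype.card D * Y ^ 2) := by positivity
  -- the change of a queue, apart from the removal at the destination
  let Δ : V → D → ℝ := fun v d => N.inflow δ f v d - N.outflow δ f v d + a v d
  have hΔ : ∀ v d, |Δ v d| ≤ Y := by
    intro v d
    have h1 := inflow_nonneg (N := N) (δ := δ) hf0 v d
    have h2 := outflow_nonneg (N := N) (δ := δ) hf0 v d
    have h3 := inflow_le (N := N) (δ := δ) hRmax.le hfR v d
    have h4 := outflow_le (N := N) (δ := δ) hRmax.le hfR v d
    have h5 := ha0 v d
    have h6 := ha v d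
    rw [abs_le, hY']
    constructor <;> simp only [Δ] <;> linarith
  have hnt : ∀ v d, v ∉ N.target d → q' v d = q v d + Δ v d := by
    intro v d hv
    rw [hq', if_neg hv]
    simp only [Δ]
    ring
  have ht : ∀ d, ∀ v ∈ N.target d, q' v d = 0 := fun d v hv => by rw [hq', if_pos hv]
  have hsumΔ : ∀ m : V → D → ℝ, ∑ v, ∑ d, m v d * Δ v d =
      -∑ e, f e * N.diff m e (δ e) + ∑ v, ∑ d, a v d * m v d := by
    intro m
    rw [← N.sum_mul_net_flow, ← Finset.sum_add_distrib]
    refine Finset.sum_congr rfl fun v _ => ?_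
    rw [← Finset.sum_add_distrib]
    refine Finset.sum_congr rfl fun d _ => ?_
    simp only [Δ]
    ring
  have hflow : ∀ e, N.sent q r δ e * N.diff q e (δ e) - Fintype.card E * Rmax ^ 2 ≤
      f e * N.diff q e (δ e) := by
    intro e
    have hs0 : 0 ≤ N.sent q r δ e := N.sent_nonneg (hmw.1.1 e)
    rcases hs0.eq_or_lt with hs | hs
    · have h1 : f e = 0 := le_antisymm (hs ▸ (hf e).2) (hf0 e)
      rw [← hs, h1]
      have : 0 ≤ Fintype.card E * Rmax ^ 2 := by positivity
      linarith
    · have hd := hmw.diff_pos hs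
      -- Either the queue suffices and the full amount is sent, or the queue, and with it the
      -- differential, is at most `card E * Rmax` and the lost weight is bounded.
      rcases le_total (N.outflow δ (N.sent q r δ) (N.tail e) (δ e)) (q (N.tail e) (δ e)) with
        h1 | h1
      · have h2 := hout (N.tail e) (δ e)
        rw [min_eq_right h1] at h2
        rw [eq_of_outflow_eq (fun e => (hf e).2) h2 rfl rfl]
        have : 0 ≤ Fintype.card E * Rmax ^ 2 := by positivity
        linarith
      · have h2 := outflow_le (N := N) (δ := δ) hRmax.le hsR (N.tail e) (δ e)
        have h3 : N.diff q e (δ e) ≤ Fintype.card E * Rmax := by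
          have := hq (N.head e) (δ e)
          unfold diff
          linarith
        have h4 : (N.sent q r δ e - f e) * N.diff q e (δ e) ≤
            Rmax * (Fintype.card E * Rmax) := by
          have h5 : N.sent q r δ e - f e ≤ Rmax := by linarith [hsR e, hf0 e]
          exact mul_le_mul h5 h3 hd.le hRmax.le
        nlinarith
  refine ⟨N.weight q r δ, {p | f p.1 ≠ 0 ∧ p.2 = δ p.1}, hmw.weight_nonneg, ?_, ht, ?_, ?_, ?_,
    ?_, ?_⟩
  · intro v d
    by_cases hv : v ∈ N.target d
    · rw [ht d v hv]
    · rw [hq', if_neg hv, hout]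
      have h1 := inflow_nonneg (N := N) (δ := δ) hf0 v d
      have h2 := ha0 v d
      have h3 := min_le_left (q v d) (N.outflow δ (N.sent q r δ) v d)
      linarith
  · intro v d
    by_cases hv : v ∈ N.target d
    · rw [ht d v hv, hqt d v hv]
      simp only [sub_self, abs_zero]
      linarith
    · rw [hnt v d hv, add_sub_cancel_left]
      linarith [hΔ v d]
  · rintro ⟨e, d⟩ ⟨he, hd⟩
    dsimp only at he hd ⊢
    subst hd
    exact hmw.diff_le hRmin hge (lt_of_lt_of_le (lt_of_le_of_ne (hf0 e) (Ne.symm he)) (hf e).2)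
  · intro m hmt hmS hma
    have h1 : ∀ v d, m v d * q' v d = m v d * q v d + m v d * Δ v d := by
      intro v d
      by_cases hv : v ∈ N.target d
      · simp [hmt d v hv]
      · rw [hnt v d hv]
        ring
    have h2 : ∑ e, f e * N.diff m e (δ e) = 0 := Finset.sum_eq_zero fun e _ => by
      by_cases he : f e = 0
      · simp [he]
      · rw [hmS (e, δ e) ⟨he, rfl⟩, mul_zero]
    have h3 : ∑ v, ∑ d, a v d * m v d = 0 := Finset.sum_eq_zero fun v _ =>
      Finset.sum_eq_zero fun d _ => by
        by_cases hav : a v d = 0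
        · simp [hav]
        · rw [hma v d hav, mul_zero]
    simp_rw [h1, Finset.sum_add_distrib]
    rw [hsumΔ m, h2, h3]
    simp
  · intro ρ hρ
    have := hmw.sum_pressure_le hRmin hge hle hρ
    linarith
  · have h1 : ∀ v d, q' v d ^ 2 ≤ q v d ^ 2 + 2 * (q v d * Δ v d) + Y ^ 2 := by
      intro v d
      have h2 : Δ v d ^ 2 ≤ Y ^ 2 := sq_le_sq' (abs_le.1 (hΔ v d)).1 (abs_le.1 (hΔ v d)).2
      by_cases hv : v ∈ N.target d
      · rw [ht d v hv, hqt d v hv]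
        nlinarith
      · rw [hnt v d hv]
        nlinarith
    have h2 : ∑ v, ∑ d, q' v d ^ 2 ≤
        ∑ v, ∑ d, (q v d ^ 2 + 2 * (q v d * Δ v d) + Y ^ 2) :=
      Finset.sum_le_sum fun v _ => Finset.sum_le_sum fun d _ => h1 v d
    simp_rw [Finset.sum_add_distrib, ← Finset.mul_sum] at h2
    rw [hsumΔ q] at h2
    have h3 : N.weight q r δ - Fintype.card E * (Fintype.card E * Rmax ^ 2) ≤
        ∑ e, f e * N.diff q e (δ e) := by
      calc _ = ∑ e, (N.sent q r δ e * N.diff q e (δ e) - Fintype.card E * Rmax ^ 2) := by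
            rw [Finset.sum_sub_distrib]
            simp [weight]
        _ ≤ _ := Finset.sum_le_sum fun e _ => hflow e
    simp only [Finset.sum_const, Finset.card_univ, nsmul_eq_mul] at h2
    linarith

end

end Network

end

/-! ### Work of the adversary's schedule, and windows of Max-Weight -/

section

variable {V E D : Type*} [Fintype V] [Fintype E] [Fintype D] [DecidableEq V] [DecidableEq D]

namespace Adversary

omit [Fintype V] [Fintype E] [Fintype D] in
theorem arrival_nonneg (A : Adversary V E D) (t : ℕ) (v : V) (d : D) : 0 ≤ A.arrival t v d :=
  Finset.sum_nonneg fun i _ => by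
    split_ifs
    · exact (A.packet t i).size_pos.le
    · exact le_rfl

omit [Fintype E] in
theorem sum_arrival_mul (A : Adversary V E D) (t : ℕ) (q : V → D → ℝ) :
    ∑ v, ∑ d, A.arrival t v d * q v d =
      ∑ i, (A.packet t i).size * q (A.packet t i).source (A.packet t i).dest := by
  unfold arrival
  simp_rw [Finset.sum_mul]
  rw [← Fintype.sum_prod_type' (f := fun v d => ∑ i : Fin (A.count t),
    (if (A.packet t i).source = v ∧ (A.packet t i).dest = d then (A.packet t i).size else 0) *
      q v d), Finset.sum_comm]
  refine Finset.sum_congr rfl fun i _ => ?_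
  rw [Finset.sum_eq_single ((A.packet t i).source, (A.packet t i).dest)]
  · simp
  · rintro ⟨v, d⟩ - hne
    have : ¬ ((A.packet t i).source = v ∧ (A.packet t i).dest = d) :=
      fun h => hne (by rw [h.1, h.2])
    simp [this]
  · simp

namespace Schedule

variable {A : Adversary V E D}

omit [Fintype D] [DecidableEq D] in
theorem sum_held_mul (T : A.Schedule) (N : Network V E D) (t : ℕ) (i : Fin (A.count t)) (s : ℕ)
    (φ : V → ℝ) :
    ∑ v, T.held N t i v s * φ v = (A.packet t i).size * φ (A.packet t i).source +
      ∑ s' ∈ Ico t s, ∑ e, T.move t i e s' * (φ (N.head e) - φ (N.tail e)) := by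
  unfold held
  simp_rw [add_mul, Finset.sum_mul, Finset.sum_add_distrib]
  congr 1
  · simp
  · rw [Finset.sum_comm]
    refine Finset.sum_congr rfl fun s' _ => ?_
    simp_rw [sub_mul, Finset.sum_mul, Finset.sum_sub_distrib, mul_sub]
    rw [Finset.sum_comm, Finset.sum_comm (s := univ (α := V)), Finset.sum_sub_distrib]
    simp

omit [DecidableEq D] in
/-- Delivering a packet takes work against the queue differentials that is at least its delivered
size times the queue size at its source. -/
theorem IsWitness.size_mul_le {T : A.Schedule} {N : Network V E D} {ω : ℕ} {ε : ℝ}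
    (hT : T.IsWitness N ω ε) {q : V → D → ℝ} (hq : ∀ v d, 0 ≤ q v d)
    (hqt : ∀ d, ∀ v ∈ N.target d, q v d = 0) (t : ℕ) (i : Fin (A.count t)) :
    (1 - ε / 2) * ((A.packet t i).size * q (A.packet t i).source (A.packet t i).dest) ≤
      ∑ s ∈ Ico t (t + ω), ∑ e, T.move t i e s * N.pressure q e := by
  set p := A.packet t i with hp
  set x := q p.source p.dest with hx
  have hx0 : 0 ≤ x := hq _ _
  -- Truncating the queue sizes at the source level `x` keeps undelivered data from counting above
  -- `x`, so each unit delivered accounts for work `x` even if the remainder sits in larger queues.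
  -- Truncation does not increase the positive part of a differential.
  have h1 := T.sum_held_mul N t i (t + ω) (fun v => min (q v p.dest) x)
  have h2 := T.sum_held_mul N t i (t + ω) (fun _ => 1)
  simp only [mul_one, sub_self, mul_zero, Finset.sum_const_zero, add_zero] at h2
  have hheld : ∀ v, 0 ≤ T.held N t i v (t + ω) := fun v => hT.held_nonneg t i v _ (by omega)
  have h3 : ∑ v, T.held N t i v (t + ω) * min (q v p.dest) x ≤
      (∑ v, T.held N t i v (t + ω) - ∑ v ∈ N.target p.dest, T.held N t i v (t + ω)) * x := by
    rw [← Finset.sum_compl_add_sum (N.target p.dest),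
      ← Finset.sum_compl_add_sum (N.target p.dest) (fun v => T.held N t i v (t + ω)),
      add_sub_cancel_right, Finset.sum_mul]
    have h4 : ∑ v ∈ N.target p.dest, T.held N t i v (t + ω) * min (q v p.dest) x = 0 :=
      Finset.sum_eq_zero fun v hv => by rw [hqt _ v hv, min_eq_left hx0, mul_zero]
    rw [h4, add_zero]
    exact Finset.sum_le_sum fun v _ => mul_le_mul_of_nonneg_left (min_le_right _ _) (hheld v)
  have h4 := hT.delivered t i
  have h5 : -∑ s ∈ Ico t (t + ω), ∑ e, T.move t i e s * N.pressure q e ≤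
      ∑ s ∈ Ico t (t + ω), ∑ e, T.move t i e s *
        (min (q (N.head e) p.dest) x - min (q (N.tail e) p.dest) x) := by
    rw [← Finset.sum_neg_distrib]
    refine Finset.sum_le_sum fun s _ => ?_
    rw [← Finset.sum_neg_distrib]
    refine Finset.sum_le_sum fun e _ => ?_
    rw [← mul_neg]
    refine mul_le_mul_of_nonneg_left ?_ (hT.move_nonneg t i e s)
    have h6 := N.pressure_nonneg q e
    have h7 := N.diff_le_pressure q e p.dest
    unfold Network.diff at h7
    rcases min_cases (q (N.head e) p.dest) x with h8 | h8 <;>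
      rcases min_cases (q (N.tail e) p.dest) x with h9 | h9 <;> linarith
  rw [← hp] at h1 h2 h4
  rw [← hx, min_self] at h1
  rw [h2] at h3
  nlinarith [mul_le_mul_of_nonneg_right h4 hx0]

/-- The amount sent along `e` in the slots `S`, of packets injected in the slots `P` that were
injected less than `ω` slots ago. -/
def load (T : A.Schedule) (ω : ℕ) (P S : Finset ℕ) (e : E) : ℝ :=
  ∑ s ∈ S, ∑ t ∈ P, ∑ i : Fin (A.count t), if t ≤ s ∧ s < t + ω then T.move t i e s else 0

omit [Fintype V] [Fintype D] [DecidableEq D] in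
theorem IsWitness.load_nonneg {T : A.Schedule} {N : Network V E D} {ω : ℕ} {ε : ℝ}
    (hT : T.IsWitness N ω ε) (P S : Finset ℕ) (e : E) : 0 ≤ T.load ω P S e :=
  Finset.sum_nonneg fun s _ => Finset.sum_nonneg fun t _ => Finset.sum_nonneg fun i _ => by
    split_ifs
    · exact hT.move_nonneg t i e s
    · exact le_rfl

/-- The work against the queue differentials `q` bounds the arrivals of a window. -/
theorem IsWitness.sum_arrival_le {T : A.Schedule} {N : Network V E D} {ω : ℕ} {ε : ℝ}
    (hT : T.IsWitness N ω ε) {q : V → D → ℝ} (hq : ∀ v d, 0 ≤ q v d)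
    (hqt : ∀ d, ∀ v ∈ N.target d, q v d = 0) (a : ℕ) :
    (1 - ε / 2) * ∑ t ∈ Ico a (a + ω), ∑ v, ∑ d, A.arrival t v d * q v d ≤
      ∑ e, N.pressure q e * T.load ω (Ico a (a + ω)) (Ico a (a + ω)) e +
      ∑ e, N.pressure q e * T.load ω (Ico a (a + ω)) (Ico (a + ω) (a + ω + ω)) e := by
  -- The `ω` slots following an injection in this window lie in this window and the next, so the two
  -- loads capture each packet's whole allowed movement.
  have h1 : ∀ e, T.load ω (Ico a (a + ω)) (Ico a (a + ω)) e +
      T.load ω (Ico a (a + ω)) (Ico (a + ω) (a + ω + ω)) e =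
      ∑ t ∈ Ico a (a + ω), ∑ i, ∑ s ∈ Ico t (t + ω), T.move t i e s := by
    intro e
    unfold load
    rw [Finset.sum_Ico_consecutive _ (by omega) (by omega), Finset.sum_comm]
    refine Finset.sum_congr rfl fun t ht => ?_
    rw [Finset.sum_comm]
    refine Finset.sum_congr rfl fun i _ => ?_
    rw [← Finset.sum_filter]
    refine Finset.sum_congr ?_ fun _ _ => rfl
    ext s
    simp only [Finset.mem_filter, Finset.mem_Ico] at ht ⊢
    omega
  rw [← Finset.sum_add_distrib]
  simp_rw [← mul_add, h1]
  simp_rw [sum_arrival_mul, Finset.mul_sum]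
  rw [Finset.sum_comm (s := univ (α := E))]
  refine Finset.sum_le_sum fun t _ => ?_
  rw [Finset.sum_comm (s := univ (α := E))]
  refine Finset.sum_le_sum fun i _ => ?_
  refine (hT.size_mul_le hq hqt t i).trans (le_of_eq ?_)
  rw [Finset.sum_comm]
  exact Finset.sum_congr rfl fun e _ => Finset.sum_congr rfl fun s _ => mul_comm _ _

omit [Fintype V] [Fintype D] [DecidableEq D] in
theorem IsWitness.load_add_load_le {T : A.Schedule} {N : Network V E D} {ω : ℕ} {ε : ℝ}
    (hT : T.IsWitness N ω ε) {γ : ℝ} (hγ : 1 - ε ≤ γ) (hrate : ∀ t e, 0 ≤ T.rate t e) (j : ℕ)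
    (e : E) :
    T.load ω (Ico (j * ω) (j * ω + ω)) (Ico (j * ω) (j * ω + ω)) e +
      T.load ω (Ico ((j - 1) * ω) (j * ω)) (Ico (j * ω) (j * ω + ω)) e ≤
      γ * ∑ s ∈ Ico (j * ω) (j * ω + ω), T.rate s e := by
  have h := hT.load_le j e
  rw [add_mul, one_mul] at h
  -- For `j = 0`, truncated subtraction makes the previous window empty.
  have h1 : (j - 1) * ω ≤ j * ω := Nat.mul_le_mul_right _ (by omega)
  have h2 : T.load ω (Ico (j * ω) (j * ω + ω)) (Ico (j * ω) (j * ω + ω)) e +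
      T.load ω (Ico ((j - 1) * ω) (j * ω)) (Ico (j * ω) (j * ω + ω)) e =
      ∑ s ∈ Ico (j * ω) (j * ω + ω), ∑ t ∈ Ico ((j - 1) * ω) (j * ω + ω),
        ∑ i : Fin (A.count t), (if t ≤ s ∧ s < t + ω then T.move t i e s else 0) := by
    unfold load
    rw [add_comm, ← Finset.sum_add_distrib]
    exact Finset.sum_congr rfl fun s _ => Finset.sum_Ico_consecutive _ h1 (by omega)
  rw [h2, Finset.mul_sum]
  exact h.trans (Finset.sum_le_sum fun s _ => mul_le_mul_of_nonneg_right hγ (hrate s e))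

end Schedule

end Adversary

namespace Network

/-- An execution of Max-Weight in which slot `t` has weight `W t` and uses the edges `S t`. -/
structure RunBound (N : Network V E D) (A : Adversary V E D) (q : ℕ → V → D → ℝ) (κ C : ℝ)
    (W : ℕ → ℝ) (S : ℕ → Set (E × D)) : Prop where
  nonneg : ∀ t v d, 0 ≤ q t v d
  target : ∀ t d, ∀ v ∈ N.target d, q t v d = 0
  slot : ∀ t, N.SlotBound (A.rates t) (A.arrival t) (q t) (q (t + 1)) κ C (W t) (S t)

variable {N : Network V E D} {A : Adversary V E D} {q : ℕ → V → D → ℝ} {κ C : ℝ} {W : ℕ → ℝ}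
  {S : ℕ → Set (E × D)}

theorem exists_runBound (N : Network V E D) {Rmin Rmax : ℝ} (hRmin : 0 < Rmin)
    (hRmax : 0 < Rmax) :
    ∃ C : ℝ, 0 ≤ C ∧ ∀ A : Adversary V E D, A.HasBoundedRates Rmin Rmax →
      ∀ q : ℕ → V → D → ℝ, N.IsMaxWeightRun A q →
        ∃ W S, N.RunBound A q (1 / Rmin + 1) C W S := by
  refine ⟨(Fintype.card E + 1) * Rmax + Fintype.card E * (2 * Rmax ^ 2) +
    2 * (Fintype.card E * (Fintype.card E * Rmax ^ 2)) +
    Fintype.card V * (Fintype.card D * ((Fintype.card E + 1) * Rmax) ^ 2), by positivity,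
    fun A hA q hq => ?_⟩
  have step := fun t (h1 : ∀ v d, 0 ≤ q t v d) (h2 : ∀ d, ∀ v ∈ N.target d, q t v d = 0) =>
    (hq.step t).exists_slotBound hRmin hRmax (hA.le_edge t) (hA.edge_le t)
      (A.arrival_nonneg t) (hA.arrival_le t) h1 h2
  have inv : ∀ t, (∀ v d, 0 ≤ q t v d) ∧ ∀ d, ∀ v ∈ N.target d, q t v d = 0 := by
    intro t
    induction t with
    | zero => exact ⟨hq.init_nonneg, hq.init_target⟩
    | succ t ih =>
      obtain ⟨W, S, h⟩ := step t ih.1 ih.2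
      exact ⟨h.nonneg, h.target⟩
  choose W S h using fun t => step t (inv t).1 (inv t).2
  exact ⟨W, S, fun t => (inv t).1, fun t => (inv t).2, h⟩

theorem RunBound.abs_sub_le (h : N.RunBound A q κ C W S) (a n : ℕ) (v : V) (d : D) :
    |q (a + n) v d - q a v d| ≤ n * C := by
  induction n with
  | zero => simp
  | succ n ih =>
    have h1 := (h.slot (a + n)).step_le v d
    have h2 := _root_.abs_sub_le (q (a + (n + 1)) v d) (q (a + n) v d) (q a v d)
    rw [← add_assoc] at h2 ⊢
    push_cast
    linarith

theorem RunBound.abs_sub_le_window (h : N.RunBound A q κ C W S) (hC : 0 ≤ C) {a ω s : ℕ}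
    (h1 : a ≤ s) (h2 : s ≤ a + ω) (v : V) (d : D) : |q s v d - q a v d| ≤ ω * C := by
  obtain ⟨n, rfl⟩ := Nat.exists_eq_add_of_le h1
  refine (h.abs_sub_le a n v d).trans (mul_le_mul_of_nonneg_right ?_ hC)
  exact_mod_cast (by omega : n ≤ ω)

theorem RunBound.sum_sq_le (h : N.RunBound A q κ C W S) (a n : ℕ) :
    ∑ v, ∑ d, q (a + n) v d ^ 2 ≤ ∑ v, ∑ d, q a v d ^ 2 +
      ∑ s ∈ Ico a (a + n), (2 * ∑ v, ∑ d, A.arrival s v d * q s v d - 2 * W s + C) := by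
  induction n with
  | zero => simp
  | succ n ih =>
    rw [← add_assoc, Finset.sum_Ico_succ_top (by omega)]
    have := (h.slot (a + n)).drift
    linarith

/-- The drift of the sum of squares over a window, in terms of the queue sizes at its start. -/
theorem RunBound.sum_sq_window_le (h : N.RunBound A q κ C W S) (hC : 0 ≤ C) {Rmax : ℝ}
    (hA : ∀ t v d, A.arrival t v d ≤ Rmax) (a ω : ℕ) :
    ∑ v, ∑ d, q (a + ω) v d ^ 2 ≤ ∑ v, ∑ d, q a v d ^ 2 +
      2 * ∑ s ∈ Ico a (a + ω), ∑ v, ∑ d, A.arrival s v d * q a v d -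
      2 * ∑ s ∈ Ico a (a + ω), W s +
      ω * (2 * (Fintype.card V * (Fintype.card D * (Rmax * (ω * C)))) + C) := by
  refine (h.sum_sq_le a ω).trans ?_
  have h1 : ∀ s ∈ Ico a (a + ω), 2 * ∑ v, ∑ d, A.arrival s v d * q s v d - 2 * W s + C ≤
      2 * ∑ v, ∑ d, A.arrival s v d * q a v d - 2 * W s +
        (2 * (Fintype.card V * (Fintype.card D * (Rmax * (ω * C)))) + C) := by
    intro s hs
    rw [Finset.mem_Ico] at hs
    have h2 : ∑ v, ∑ d, A.arrival s v d * q s v d ≤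
        ∑ v, ∑ d, (A.arrival s v d * q a v d + Rmax * (ω * C)) := by
      refine Finset.sum_le_sum fun v _ => Finset.sum_le_sum fun d _ => ?_
      have h3 := (abs_le.1 (h.abs_sub_le_window hC hs.1 hs.2.le v d)).2
      have h4 := A.arrival_nonneg s v d
      have h5 : 0 ≤ (ω : ℝ) * C := by positivity
      nlinarith [mul_le_mul_of_nonneg_left h3 h4, mul_le_mul_of_nonneg_right (hA s v d) h5]
    simp only [Finset.sum_add_distrib, Finset.sum_const, Finset.card_univ, nsmul_eq_mul] at h2
    linarith
  have h2 := Finset.sum_le_sum h1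
  simp only [Finset.sum_add_distrib, Finset.sum_sub_distrib, ← Finset.mul_sum, Finset.sum_const,
    Nat.card_Ico, nsmul_eq_mul, add_tsub_cancel_left] at h2 ⊢
  linarith

/-- Within a window queues move by at most `ω * C` and pressures by at most `2 * (ω * C)`, so the
slotwise bounds can be summed with the pressures frozen at its start. -/
theorem RunBound.sum_pressure_window_le (h : N.RunBound A q κ C W S) (hC : 0 ≤ C) {Rmax : ℝ}
    {ρ : ℕ → E → ℝ} (hρ : ∀ t, ρ t ∈ A.rates t) (hρ0 : ∀ t e, 0 ≤ ρ t e)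
    (hρR : ∀ t e, ρ t e ≤ Rmax) (a ω : ℕ) :
    ∑ e, N.pressure (q a) e * ∑ s ∈ Ico a (a + ω), ρ s e ≤
      ∑ s ∈ Ico a (a + ω), W s +
        ω * (C + Fintype.card E * (Rmax * (2 * (ω * C)))) := by
  simp_rw [Finset.mul_sum]
  rw [Finset.sum_comm]
  have h1 : ∀ s ∈ Ico a (a + ω), ∑ e, N.pressure (q a) e * ρ s e ≤
      W s + (C + Fintype.card E * (Rmax * (2 * (ω * C)))) := by
    intro s hs
    rw [Finset.mem_Ico] at hs
    have hy : 0 ≤ (ω : ℝ) * C := by positivity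
    have h2 : ∑ e, N.pressure (q a) e * ρ s e ≤
        ∑ e, (ρ s e * N.pressure (q s) e + Rmax * (2 * (ω * C))) := by
      refine Finset.sum_le_sum fun e _ => ?_
      have h3 := N.pressure_le_add (q := q a) (q' := q s) hy (fun v d => by
        rw [abs_sub_comm]
        exact h.abs_sub_le_window hC hs.1 hs.2.le v d) e
      have h4 := mul_le_mul_of_nonneg_left h3 (hρ0 s e)
      have h5 := mul_le_mul_of_nonneg_right (hρR s e) (by linarith : 0 ≤ 2 * ((ω : ℝ) * C))
      nlinarith
    have h3 := (h.slot s).sum_pressure_le (ρ s) (hρ s)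
    simp only [Finset.sum_add_distrib, Finset.sum_const, Finset.card_univ, nsmul_eq_mul] at h2
    linarith
  have h2 := Finset.sum_le_sum h1
  simp only [Finset.sum_add_distrib, Finset.sum_const, Nat.card_Ico, nsmul_eq_mul,
    add_tsub_cancel_left] at h2 ⊢
  linarith

end Network

end

/-! ### Windows of Max-Weight as a linked drift -/

section

variable {V E D : Type*} [Fintype V] [Fintype E] [Fintype D] [DecidableEq V] [DecidableEq D]

namespace Network

/-- The queue sizes at the beginning of window `j`, with a base point at level `0`. -/
def windowState (ω : ℕ) (q : ℕ → V → D → ℝ) (j : ℕ) (i : Option (V × D)) : ℝ :=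
  i.elim 0 fun p => q (j * ω) p.1 p.2

/-- Two queues are linked if data is sent from the first to the second in window `j`. Queues with
arrivals and queues at their destination are linked to the base point. -/
def windowLink (N : Network V E D) (A : Adversary V E D) (S : ℕ → Set (E × D)) (ω j : ℕ)
    (a b : Option (V × D)) : Prop :=
  (∃ s ∈ Ico (j * ω) (j * ω + ω), ∃ p ∈ S s,
    a = some (N.tail p.1, p.2) ∧ b = some (N.head p.1, p.2)) ∨
  (∃ s ∈ Ico (j * ω) (j * ω + ω), ∃ v d, A.arrival s v d ≠ 0 ∧ a = some (v, d) ∧ b = none) ∨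
  ∃ d, ∃ v ∈ N.target d, a = some (v, d) ∧ b = none

variable {N : Network V E D} {A : Adversary V E D} {q : ℕ → V → D → ℝ} {κ C : ℝ} {W : ℕ → ℝ}
  {S : ℕ → Set (E × D)}

omit [DecidableEq V] [DecidableEq D] in
theorem sum_windowState (ω : ℕ) (q : ℕ → V → D → ℝ) (j : ℕ) (m : Option (V × D) → ℝ)
    (h : m none = 0) :
    ∑ i, m i * windowState ω q j i = ∑ v, ∑ d, m (some (v, d)) * q (j * ω) v d := by
  rw [Fintype.sum_option, h, zero_mul, zero_add, Fintype.sum_prod_type]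
  rfl

omit [DecidableEq V] [DecidableEq D] in
theorem sum_windowState_sq (ω : ℕ) (q : ℕ → V → D → ℝ) (j : ℕ) :
    ∑ i, windowState ω q j i ^ 2 = ∑ v, ∑ d, q (j * ω) v d ^ 2 := by
  rw [Fintype.sum_option, Fintype.sum_prod_type]
  simp [windowState]

theorem RunBound.conserve_window (h : N.RunBound A q κ C W S) (ω j : ℕ)
    (m : Option (V × D) → ℝ) (h0 : m none = 0)
    (hm : ∀ a b, N.windowLink A S ω j a b → m a = m b) :
    ∑ i, m i * windowState ω q (j + 1) i = ∑ i, m i * windowState ω q j i := by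
  rw [sum_windowState ω q _ m h0, sum_windowState ω q _ m h0, add_mul, one_mul]
  have key : ∀ n ≤ ω, ∑ v, ∑ d, m (some (v, d)) * q (j * ω + n) v d =
      ∑ v, ∑ d, m (some (v, d)) * q (j * ω) v d := by
    intro n
    induction n with
    | zero => intro _; rfl
    | succ n ih =>
      intro hn
      rw [← ih (by omega), ← add_assoc]
      have hmem : j * ω + n ∈ Ico (j * ω) (j * ω + ω) := by
        rw [Finset.mem_Ico]
        omega
      refine (h.slot (j * ω + n)).conserve (fun v d => m (some (v, d))) ?_ ?_ ?_
      · exact fun d v hv => (hm _ _ (Or.inr (Or.inr ⟨d, v, hv, rfl, rfl⟩))).trans h0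
      · exact fun p hp => sub_eq_zero.2 (hm _ _ (Or.inl ⟨_, hmem, p, hp, rfl, rfl⟩))
      · exact fun v d hvd =>
          (hm _ _ (Or.inr (Or.inl ⟨_, hmem, v, d, hvd, rfl, rfl⟩))).trans h0
  exact key ω le_rfl

/-- The total weight of the choices in the window from `a` to `a + ω` and of its arrivals. -/
noncomputable def work (A : Adversary V E D) (q : ℕ → V → D → ℝ) (W : ℕ → ℝ) (ω a : ℕ) : ℝ :=
  ∑ s ∈ Ico a (a + ω), W s + ∑ s ∈ Ico a (a + ω), ∑ v, ∑ d, A.arrival s v d * q a v d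

theorem RunBound.sum_weight_nonneg (h : N.RunBound A q κ C W S) (ω a : ℕ) :
    0 ≤ ∑ s ∈ Ico a (a + ω), W s :=
  Finset.sum_nonneg fun s _ => (h.slot s).weight_nonneg

theorem RunBound.sum_arrival_nonneg (h : N.RunBound A q κ C W S) (ω a : ℕ) :
    0 ≤ ∑ s ∈ Ico a (a + ω), ∑ v, ∑ d, A.arrival s v d * q a v d :=
  Finset.sum_nonneg fun s _ => Finset.sum_nonneg fun v _ => Finset.sum_nonneg fun d _ =>
    mul_nonneg (A.arrival_nonneg s v d) (h.nonneg a v d)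

/-- A used edge has differential bounded in terms of the weight of its slot. A nonzero arrival is at
least `Rmin`, so the queue it joins is at most the arrival work divided by `Rmin`. Queues at their
destination are empty. The term `2 * (ω * C)` accounts for measuring at the start of the window. -/
theorem RunBound.link_le {Rmin : ℝ} (hRmin : 0 < Rmin) (hC : 0 ≤ C)
    (h : N.RunBound A q (1 / Rmin + 1) C W S)
    (hA : ∀ t v d, A.arrival t v d ≠ 0 → Rmin ≤ A.arrival t v d) {ω j : ℕ}
    {a b : Option (V × D)} (hab : N.windowLink A S ω j a b) :
    |windowState ω q j a - windowState ω q j b| ≤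
      1 + 2 * (ω * C) + (1 / Rmin + 1) * work A q W ω (j * ω) := by
  have hκ : 0 ≤ 1 / Rmin + 1 := by positivity
  have hw := h.sum_weight_nonneg ω (j * ω)
  have ha := h.sum_arrival_nonneg ω (j * ω)
  have hy : 0 ≤ (ω : ℝ) * C := by positivity
  have hu := mul_nonneg hκ (add_nonneg hw ha)
  unfold work
  rcases hab with ⟨s, hs, ⟨e, d⟩, hp, rfl, rfl⟩ | ⟨s, hs, v, d, hvd, rfl, rfl⟩ |
    ⟨d, v, hv, rfl, rfl⟩
  · have h1 := (h.slot s).diff_le (e, d) hp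
    have h2 : W s ≤ ∑ s ∈ Ico (j * ω) (j * ω + ω), W s :=
      Finset.single_le_sum (fun s _ => (h.slot s).weight_nonneg) hs
    have h3 := mul_le_mul_of_nonneg_left (h2.trans (le_add_of_nonneg_right ha)) hκ
    rw [Finset.mem_Ico] at hs
    have h4 := abs_le.1 (h.abs_sub_le_window hC hs.1 hs.2.le (N.tail e) d)
    have h5 := abs_le.1 (h.abs_sub_le_window hC hs.1 hs.2.le (N.head e) d)
    have h6 := abs_le.1 h1
    simp only [diff] at h6
    simp only [windowState, Option.elim]
    rw [abs_le]
    constructor <;> linarith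
  · have h1 : A.arrival s v d * q (j * ω) v d ≤
        ∑ s ∈ Ico (j * ω) (j * ω + ω), ∑ v, ∑ d, A.arrival s v d * q (j * ω) v d := by
      have hnn : ∀ s v d, 0 ≤ A.arrival s v d * q (j * ω) v d := fun s v d =>
        mul_nonneg (A.arrival_nonneg s v d) (h.nonneg _ v d)
      refine le_trans ?_ (Finset.single_le_sum (fun s _ => Finset.sum_nonneg fun v _ =>
        Finset.sum_nonneg fun d _ => hnn s v d) hs)
      refine le_trans ?_ (Finset.single_le_sum (fun v _ =>
        Finset.sum_nonneg fun d _ => hnn s v d) (mem_univ v))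
      exact Finset.single_le_sum (f := fun d => A.arrival s v d * q (j * ω) v d)
        (fun d _ => hnn s v d) (mem_univ d)
    have h2 := h.nonneg (j * ω) v d
    have h3 := mul_le_mul_of_nonneg_right (hA s v d hvd) h2
    set X := ∑ s ∈ Ico (j * ω) (j * ω + ω), ∑ v, ∑ d, A.arrival s v d * q (j * ω) v d
    set Y := ∑ s ∈ Ico (j * ω) (j * ω + ω), W s
    have h4 : q (j * ω) v d ≤ 1 / Rmin * X := by
      rw [one_div_mul_eq_div, le_div_iff₀ hRmin]
      linarith
    have h5 : 0 ≤ 1 / Rmin * Y := by positivity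
    simp only [windowState, Option.elim, sub_zero, abs_of_nonneg h2]
    linarith
  · simp only [windowState, Option.elim, h.target _ d v hv, sub_zero, abs_zero]
    linarith

/-- With `Φ = ∑ q² - θ * (work of packets of the previous window)`, the drift of `Φ` over a
window is negative up to a constant. -/
theorem exists_linkedDrift (N : Network V E D) (ω : ℕ) {ε : ℝ} (hε : 0 < ε) (hε_lt : ε < 2)
    {Rmin Rmax : ℝ} (hRmin : 0 < Rmin) (hRmax : 0 < Rmax) (hC : 0 ≤ C) :
    ∃ C' c Z : ℝ, 0 < c ∧ 0 ≤ C' ∧ 0 ≤ Z ∧ ∀ A : Adversary V E D, A.HasBoundedRates Rmin Rmax →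
      A.IsWindowAdversary N ω ε → ∀ q W S, N.RunBound A q (1 / Rmin + 1) C W S →
      ∃ w Φ, LinkedDrift none C' c (windowState ω q) w Φ (N.windowLink A S ω) ∧
        ∀ j, ∑ v, ∑ d, q (j * ω) v d ^ 2 ≤ Φ j + Z * ∑ e, N.pressure (q (j * ω)) e := by
  -- The usable fraction `γ` is strictly below the delivered fraction `1 - ε / 2`; the maximum with
  -- `0` covers `ε > 1`. This gap is the source of the negative drift.
  obtain ⟨γ, hγ0, hγε, hγ1, hγβ⟩ : ∃ γ : ℝ, 0 ≤ γ ∧ 1 - ε ≤ γ ∧ γ ≤ 1 ∧ γ < 1 - ε / 2 :=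
    ⟨max (1 - ε) 0, le_max_right _ _, le_max_left _ _, max_le (by linarith) zero_le_one,
      max_lt (by linarith) (by linarith)⟩
  obtain ⟨β, hβ⟩ : ∃ β : ℝ, β = 1 - ε / 2 := ⟨_, rfl⟩
  rw [← hβ] at hγβ
  have hβ0 : 0 < β := by linarith
  have hβ1 : β < 1 := by linarith
  -- The factor `θ` lies strictly above `2 / β`, so that arrivals are overpaid, yet `θ * γ` stays
  -- below `2`, so that the weight of Max-Weight still wins.
  obtain ⟨θ, hθ⟩ : ∃ θ : ℝ, θ = (2 + (β - γ)) / β := ⟨_, rfl⟩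
  have hθ0 : 0 ≤ θ := by
    rw [hθ]
    exact div_nonneg (by linarith) hβ0.le
  have hθβ : θ * β = 2 + (β - γ) := by rw [hθ, div_mul_cancel₀ _ hβ0.ne']
  have hθγ : θ * γ < 2 := by
    rw [hθ, div_mul_eq_mul_div, div_lt_iff₀ hβ0]
    nlinarith
  obtain ⟨c₀, hc₀, hc₁, hc₂⟩ : ∃ c₀ : ℝ, 0 < c₀ ∧ c₀ ≤ β - γ ∧ c₀ ≤ 2 - θ * γ :=
    ⟨min (β - γ) (2 - θ * γ), lt_min (by linarith) (by linarith), min_le_left _ _,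
      min_le_right _ _⟩
  obtain ⟨κ, hκ⟩ : ∃ κ : ℝ, κ = 1 / Rmin + 1 := ⟨_, rfl⟩
  have hκ1 : 1 ≤ κ := by
    rw [hκ]
    have : 0 ≤ 1 / Rmin := by positivity
    linarith
  have hκ0 : 0 < κ := by linarith
  have hω0 : (0 : ℝ) ≤ ω := Nat.cast_nonneg _
  have hy : 0 ≤ (ω : ℝ) * C := by positivity
  obtain ⟨K₁, hK₁⟩ : ∃ K₁ : ℝ, K₁ = ω * (C + Fintype.card E * (Rmax * (2 * (ω * C)))) := ⟨_, rfl⟩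
  obtain ⟨K₂, hK₂⟩ : ∃ K₂ : ℝ, K₂ =
      ω * (2 * (Fintype.card V * (Fintype.card D * (Rmax * (ω * C)))) + C) := ⟨_, rfl⟩
  obtain ⟨K₃, hK₃⟩ : ∃ K₃ : ℝ, K₃ = Fintype.card E * (2 * (ω * C) * (ω * Rmax)) := ⟨_, rfl⟩
  have hK₁0 : 0 ≤ K₁ := by rw [hK₁]; positivity
  have hK₂0 : 0 ≤ K₂ := by rw [hK₂]; positivity
  have hK₃0 : 0 ≤ K₃ := by rw [hK₃]; positivity
  have hZ0 : 0 ≤ θ * (ω * Rmax) := by positivity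
  obtain ⟨X₁, hX₁⟩ : ∃ X₁ : ℝ, X₁ = θ * γ * K₁ + K₂ + θ * K₃ + c₀ / κ * (1 + 2 * (ω * C)) :=
    ⟨_, rfl⟩
  have hX₁0 : 0 ≤ X₁ := by rw [hX₁]; positivity
  have hX₂0 : 0 ≤ θ * γ * (1 + K₁) := by positivity
  refine ⟨ω * C + X₁ + θ * γ * (1 + K₁), c₀ / κ, θ * (ω * Rmax), by positivity, by positivity,
    hZ0, ?_⟩
  intro A hA hadv q W S h
  obtain ⟨T, hT⟩ := hadv
  have hrate0 : ∀ t e, 0 ≤ T.rate t e := fun t e => by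
    by_cases h0 : T.rate t e = 0
    · exact h0.ge
    · exact hRmin.le.trans (hA.le_edge t _ (hT.rate_mem t) e h0)
  have hrateR : ∀ t e, T.rate t e ≤ Rmax := fun t e => hA.edge_le t _ (hT.rate_mem t) e
  let win : ℕ → Finset ℕ := fun j => Ico (j * ω) (j * ω + ω)
  let prev : ℕ → Finset ℕ := fun j => Ico ((j - 1) * ω) (j * ω)
  let sq : ℕ → ℝ := fun j => ∑ v, ∑ d, q (j * ω) v d ^ 2
  let old : ℕ → ℝ := fun j =>
    ∑ e, N.pressure (q (j * ω)) e * T.load ω (prev j) (win j) e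
  let new : ℕ → ℝ := fun j =>
    ∑ e, N.pressure (q (j * ω)) e * T.load ω (win j) (win j) e
  have hold0 : ∀ j, 0 ≤ old j := fun j => Finset.sum_nonneg fun e _ =>
    mul_nonneg (N.pressure_nonneg _ e) (hT.load_nonneg _ _ e)
  have hnew0 : ∀ j, 0 ≤ new j := fun j => Finset.sum_nonneg fun e _ =>
    mul_nonneg (N.pressure_nonneg _ e) (hT.load_nonneg _ _ e)
  have hload : ∀ j e, T.load ω (prev j) (win j) e ≤ ω * Rmax := by
    intro j e
    have h1 := hT.load_add_load_le hγε hrate0 j e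
    have h2 := hT.load_nonneg (win j) (win j) e
    have h3 : ∑ s ∈ win j, T.rate s e ≤ ω * Rmax := by
      calc ∑ s ∈ win j, T.rate s e ≤ ∑ _s ∈ win j, Rmax :=
            Finset.sum_le_sum fun s _ => hrateR s e
        _ = _ := by simp [win]
    have h4 : 0 ≤ ∑ s ∈ win j, T.rate s e := Finset.sum_nonneg fun s _ => hrate0 s e
    have h5 := mul_le_mul_of_nonneg_right hγ1 h4
    simp only [win, prev] at *
    linarith
  have hcap : ∀ j, new j + old j ≤ γ * (∑ s ∈ win j, W s + K₁) := by
    intro j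
    have h1 := h.sum_pressure_window_le hC hT.rate_mem hrate0 hrateR (j * ω) ω
    rw [← hK₁] at h1
    refine le_trans ?_ (mul_le_mul_of_nonneg_left h1 hγ0)
    simp only [new, old]
    rw [← Finset.sum_add_distrib, Finset.mul_sum]
    refine Finset.sum_le_sum fun e _ => ?_
    rw [← mul_add, mul_left_comm]
    exact mul_le_mul_of_nonneg_left (hT.load_add_load_le hγε hrate0 j e)
      (N.pressure_nonneg _ e)
  have hserve : ∀ j, β * ∑ s ∈ win j, ∑ v, ∑ d, A.arrival s v d * q (j * ω) v d ≤
      new j + old (j + 1) + K₃ := by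
    intro j
    have h1 := hT.sum_arrival_le (h.nonneg (j * ω)) (h.target (j * ω)) (j * ω)
    rw [← hβ] at h1
    refine h1.trans ?_
    rw [add_assoc (new j)]
    refine add_le_add le_rfl ?_
    have hj : (j + 1) * ω = j * ω + ω := by ring
    have h2 : ∀ e, N.pressure (q (j * ω)) e * T.load ω (win j) (win (j + 1)) e ≤
        N.pressure (q ((j + 1) * ω)) e * T.load ω (prev (j + 1)) (win (j + 1)) e +
          2 * (ω * C) * (ω * Rmax) := by
      intro e
      have h3 := N.pressure_le_add (q := q (j * ω)) (q' := q ((j + 1) * ω)) hy (fun v d => by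
        rw [abs_sub_comm]
        exact h.abs_sub_le_window hC (by omega) (by omega) v d) e
      -- What is left over from window `j` is the old load of window `j + 1`, so subtracting `θ *
      -- old` makes this term telescope.
      have h4 : win j = prev (j + 1) := by simp [win, prev, hj]
      have h5 := hload (j + 1) e
      have h6 := hT.load_nonneg (prev (j + 1)) (win (j + 1)) e
      rw [h4]
      nlinarith [mul_le_mul_of_nonneg_right h3 h6,
        mul_le_mul_of_nonneg_left h5 (by linarith : 0 ≤ 2 * ((ω : ℝ) * C))]
    have h3 := Finset.sum_le_sum fun e (_ : e ∈ univ) => h2 e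
    rw [Finset.sum_add_distrib] at h3
    simp only [Finset.sum_const, Finset.card_univ, nsmul_eq_mul, ← hK₃] at h3
    simpa only [win, old, hj] using h3
  have hdrift : ∀ j, sq (j + 1) ≤ sq j +
      2 * ∑ s ∈ win j, ∑ v, ∑ d, A.arrival s v d * q (j * ω) v d -
      2 * ∑ s ∈ win j, W s + K₂ := by
    intro j
    have h1 := h.sum_sq_window_le hC hA.arrival_le (j * ω) ω
    rw [← hK₂] at h1
    simp only [sq, add_mul, one_mul]
    exact h1
  have hold : ∀ j, old j ≤ γ * (∑ s ∈ win j, W s + K₁) := fun j => by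
    linarith [hcap j, hnew0 j]
  refine ⟨fun j => 1 + 2 * (ω * C) + κ * work A q W ω (j * ω), fun j => sq j - θ * old j,
    ⟨fun t => rfl, ?_, ?_, ?_, ?_, ?_, ?_, ?_⟩, ?_⟩
  · rintro j (_ | ⟨v, d⟩)
    · simp only [windowState, Option.elim, sub_self, abs_zero]
      linarith
    · have hj : (j + 1) * ω = j * ω + ω := by ring
      have := h.abs_sub_le_window hC (a := j * ω) (s := (j + 1) * ω) (by omega) hj.le v d
      simp only [windowState, Option.elim]
      linarith
  · exact fun j m h0 hm => h.conserve_window ω j m h0 hm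
  · intro j a b hab
    have := h.link_le hRmin hC hA.le_arrival hab
    rwa [← hκ] at this
  · intro j
    have := mul_nonneg hκ0.le
      (add_nonneg (h.sum_weight_nonneg ω (j * ω)) (h.sum_arrival_nonneg ω (j * ω)))
    unfold work
    linarith
  -- Substituting `hserve` and `hcap` into `hdrift` leaves `-(β - γ)` times the arrival work and
  -- `-(2 - θ * γ)` times the weight, up to constants; `c₀` is a lower bound for both coefficients.
  · intro j
    have h1 := hdrift j
    have h2 := mul_le_mul_of_nonneg_left (hserve j) hθ0
    have h3 := mul_le_mul_of_nonneg_left (hcap j) hθ0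
    have h4 := h.sum_weight_nonneg ω (j * ω)
    have h5 := h.sum_arrival_nonneg ω (j * ω)
    have h6 : c₀ / κ * (1 + 2 * (ω * C) + κ * work A q W ω (j * ω)) =
        c₀ / κ * (1 + 2 * (ω * C)) + c₀ * work A q W ω (j * ω) := by
      rw [mul_add, ← mul_assoc (c₀ / κ), div_mul_cancel₀ _ hκ0.ne']
    rw [h6]
    unfold work
    simp only [win] at h1 h2 h3
    rw [← mul_assoc, hθβ] at h2
    set X := ∑ s ∈ Ico (j * ω) (j * ω + ω), ∑ v, ∑ d, A.arrival s v d * q (j * ω) v d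
    set Y := ∑ s ∈ Ico (j * ω) (j * ω + ω), W s
    have h7 := mul_le_mul_of_nonneg_right hc₁ h5
    have h8 := mul_le_mul_of_nonneg_right hc₂ h4
    linarith
  · intro j
    rw [sum_windowState_sq]
    have := mul_nonneg hθ0 (hold0 j)
    simp only [sq]
    linarith
  · intro j
    rw [sum_windowState_sq]
    have h1 := mul_le_mul_of_nonneg_left (hold j) hθ0
    have h4 := h.sum_weight_nonneg ω (j * ω)
    have h5 := h.sum_arrival_nonneg ω (j * ω)
    unfold work
    simp only [win] at h1
    simp only [sq]
    set X := ∑ s ∈ Ico (j * ω) (j * ω + ω), ∑ v, ∑ d, A.arrival s v d * q (j * ω) v d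
    set Y := ∑ s ∈ Ico (j * ω) (j * ω + ω), W s
    have h6 : 1 * (Y + X) ≤ κ * (Y + X) := mul_le_mul_of_nonneg_right hκ1 (by linarith)
    have h7 : θ * (γ * (Y + K₁)) ≤ θ * γ * (1 + K₁) * (1 + Y) := by
      have : 0 ≤ θ * γ := by positivity
      nlinarith [mul_nonneg this (mul_nonneg hK₁0 h4)]
    have h8 : θ * γ * (1 + K₁) * (1 + Y) ≤ (ω * C + X₁ + θ * γ * (1 + K₁)) *
        (1 + (1 + 2 * (ω * C) + κ * (Y + X))) :=
      mul_le_mul (by linarith) (by linarith) (by linarith) (by linarith)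
    linarith
  · intro j
    have h1 : old j ≤ (ω * Rmax) * ∑ e, N.pressure (q (j * ω)) e := by
      rw [Finset.mul_sum]
      refine Finset.sum_le_sum fun e _ => ?_
      rw [mul_comm]
      exact mul_le_mul_of_nonneg_right (hload j e) (N.pressure_nonneg _ e)
    have h2 := mul_le_mul_of_nonneg_left h1 hθ0
    simp only [sq]
    linarith

-- With `x` the Euclidean norm of the queues, every pressure is at most `x`, so `x ^ 2 ≤ b + Z *
-- card E * x`, which bounds `x`.
omit [DecidableEq V] [DecidableEq D] in
theorem le_of_sum_sq_le (N : Network V E D) {q : V → D → ℝ} (hq : ∀ v d, 0 ≤ q v d) {b Z : ℝ}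
    (hb : 0 ≤ b) (hZ : 0 ≤ Z)
    (h : ∑ v, ∑ d, q v d ^ 2 ≤ b + Z * ∑ e, N.pressure q e) (v : V) (d : D) :
    q v d ≤ 1 + b + Z * Fintype.card E := by
  set x := √(∑ v, ∑ d, q v d ^ 2) with hx
  have hnn : 0 ≤ ∑ v, ∑ d, q v d ^ 2 := by positivity
  have hx0 : 0 ≤ x := Real.sqrt_nonneg _
  have hxsq : x ^ 2 = ∑ v, ∑ d, q v d ^ 2 := Real.sq_sqrt hnn
  have hle : ∀ v d, q v d ≤ x := by
    intro v d
    apply Real.le_sqrt_of_sq_le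
    refine le_trans ?_ (Finset.single_le_sum (fun v _ => by positivity) (mem_univ v))
    exact Finset.single_le_sum (f := fun d => q v d ^ 2) (fun d _ => by positivity) (mem_univ d)
  have hp : ∑ e, N.pressure q e ≤ Fintype.card E * x := by
    calc ∑ e, N.pressure q e ≤ ∑ _e : E, x := Finset.sum_le_sum fun e _ =>
          N.pressure_le hx0 fun d => by
            have h1 := hle (N.tail e) d
            have h2 := hq (N.head e) d
            unfold diff
            linarith
      _ = _ := by simp
  have h1 := mul_le_mul_of_nonneg_left hp hZ
  rw [← hxsq] at h
  refine (hle v d).trans ?_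
  have hE : 0 ≤ Z * Fintype.card E := by positivity
  by_contra! hcon
  nlinarith

end Network

end

end AdversarialQueueing

/-! ### Stability of Max-Weight -/

/-- Max-Weight is stable under every `(ω, ε)`-adversary: the queue sizes are bounded for all time,
by a bound that depends only on the network, on `ω`, `ε`, on the bounds on the rates, and on a
bound on the initial queue sizes. -/
theorem theorem1 {V E D : Type*} [Fintype V] [Fintype E] [Fintype D]
    [DecidableEq V] [DecidableEq D] (N : AdversarialQueueing.Network V E D)
    (ω : ℕ) (hω : 1 ≤ ω) (ε : ℝ) (hε : 0 < ε) (hε_lt : ε < 2)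
    (Rmin Rmax : ℝ) (hRmin : 0 < Rmin) (hRmax : 0 < Rmax) (q₀ : ℝ) :
    ∃ B : ℝ, ∀ A : AdversarialQueueing.Adversary V E D,
      A.HasBoundedRates Rmin Rmax → A.IsWindowAdversary N ω ε →
      ∀ q : ℕ → V → D → ℝ, N.IsMaxWeightRun A q → (∀ v d, q 0 v d ≤ q₀) →
      ∀ t v d, q t v d ≤ B := by
  obtain ⟨C, hC, hrun⟩ := N.exists_runBound hRmin hRmax
  obtain ⟨C', c, Z, hc, hC', hZ, hdrift⟩ :=
    N.exists_linkedDrift ω hε hε_lt hRmin hRmax hC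
  obtain ⟨B, hB⟩ := AdversarialQueueing.LinkedDrift.exists_potential_le
    (none : Option (V × D)) hc hC'
  let b : ℝ := Fintype.card V * (Fintype.card D * q₀ ^ 2) + |B|
  have hb : 0 ≤ b := by positivity
  refine ⟨1 + b + Z * Fintype.card E + ω * C, fun A hA hadv q hq hq₀ t v d => ?_⟩
  obtain ⟨W, S, h⟩ := hrun A hA q hq
  obtain ⟨w, Φ, H, hΦ⟩ := hdrift A hA hadv q W S h
  have h0 : Φ 0 ≤ Fintype.card V * (Fintype.card D * q₀ ^ 2) := by
    refine (H.le_sq 0).trans ?_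
    rw [AdversarialQueueing.Network.sum_windowState_sq]
    calc ∑ v, ∑ d, q (0 * ω) v d ^ 2 ≤ ∑ _v : V, ∑ _d : D, q₀ ^ 2 :=
          Finset.sum_le_sum fun v _ => Finset.sum_le_sum fun d _ => by
            rw [zero_mul]
            exact pow_le_pow_left₀ (h.nonneg 0 v d) (hq₀ v d) 2
      _ = _ := by simp
  -- The potential controls only the starts of windows; the term `ω * C` in the final bound covers
  -- the slots in between.
  have h1 : q (t / ω * ω) v d ≤ 1 + b + Z * Fintype.card E := by
    refine N.le_of_sum_sq_le (h.nonneg _) hb hZ ((hΦ (t / ω)).trans ?_) v d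
    have h2 := hB _ _ _ _ H (t / ω)
    have h3 := le_abs_self B
    simp only [b]
    linarith
  have h2 := Nat.div_mul_le_self t ω
  have h3 := Nat.lt_div_mul_add (a := t) hω
  have h4 := (abs_le.1 (h.abs_sub_le_window hC h2 h3.le v d)).2
  linarith
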